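/- Let $\mathcal A$ be a finite set of actions with $|\mathcal A|\ge 2$ and $\mathcal V$ a countably infinite set of variables. Terms of $\mathrm{BCCSP}_{\|}$ are given by $t ::= \mathbf 0 \mid x \mid a.t \mid t+t \mid t\,\|\,t$ ($x\in\mathcal V$, $a\in\mathcal A$); a term is closed if it contains no variables. Transitions are given by the rules $a.t\xrightarrow{a}t$; $t+u\xrightarrow{a}t'$ and $u+t\xrightarrow{a}t'$ if $t\xrightarrow{a}t'$; $t\,\|\,u\xrightarrow{a}t'\,\|\,u$ and $u\,\|\,t\xrightarrow{a}u\,\|\,t'$ if $t\xrightarrow{a}t'$ (pure interleaving). For closed $p$ let $\mathtt T(p)=\{\alpha\in\mathcal A^*\mid p\xrightarrow{\alpha}p' \text{ for some } p'\}$ and $\mathtt{PF}(p)=\{(\alpha,\mathtt T(p'))\mid p\xrightarrow{\alpha}p'\}$. Closed terms $p,q$ are possible futures equivalent (also known as $2$-nested trace equivalent), $p\sim_{\mathtt{PF}}q$, if $\mathtt{PF}(p)=\mathtt{PF}(q)$. For arbitrary terms, $t\sim_{\mathtt{PF}}u$ means $\sigma(t)\sim_{\mathtt{PF}}\sigma(u)$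 for every substitution $\sigma$ of closed terms for variables; the equation $t\approx u$ is then called sound. An axiom system $\mathcal E$ (a set of equations between terms) is sound if all its equations are. $\mathcal E\vdash t\approx u$ denotes derivability in equational logic (axioms, reflexivity, symmetry, transitivity, substitution, and congruence for $a.\_$, $+$ and $\|$). $\mathcal E$ is ground-complete if $\mathcal E\vdash p\approx q$ whenever $p,q$ are closed and $p\sim_{\mathtt{PF}}q$. The size of a term is its number of occurrences of the operators $a.\_$, $+$, $\|$. The summands of a term are the terms other than $\mathbf 0$ and without $+$ as head operator of which it is a sum. A term has no $\mathbf 0$ summands or factors if no argument of a subterm of the form $t_1+t_2$ or $t_1\,\|\,t_2$ is $\sim_{\mathtt{PF}}\mathbf 0$. For actions $a\ne b$ write $b^0a=a.\mathbf 0$, $b^{i+1}a=b.(b^ia)$ and, for $N\ge1$, $p_N=\sum_{i=1}^N b^ia$; let $e_N$ be the equation $$a\,\|\,p_N\;\approx\; a\,p_N+\sum_{i=1}^N b\,(a\,\|\,b^{i-1}a),$$ where $a$ standing alone as a term abbreviates $a.\mathbf 0$. **Theorem.** Possible futures equivalence has no finite, sound and ground-complete equational axiomatisation over $\mathrm{BCCSP}_{\|}$.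 More precisely, for all actions $a\neq b$: 1. For every $N\ge1$ the equation $e_N$ is sound; its left-hand side has a summand possible futures equivalent to $a\,\|\,p_N$, and its right-hand side has no such summand. 2. Let $\mathcal E$ be a finite sound axiom system, and let $N\ge1$ be larger than the size of each term in the equations of $\mathcal E$. Then $\mathcal E\not\vdash e_N$. Moreover, if $p,q$ are closed terms without $\mathbf 0$ summands or factors such that $p\sim_{\mathtt{PF}}q\sim_{\mathtt{PF}}a\,\|\,p_N$ and $\mathcal E\vdash p\approx q$, and if $p$ has a summand possible futures equivalent to $a\,\|\,p_N$, then so does $q$. -/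

import Mathlib

namespace BCCSP

/-- Terms of BCCSP with interleaving parallel composition, over actions `A` and variables `V`:
`t ::= 0 | x | a.t | t + t | t ‖ t`. -/
inductive Term (A : Type*) (V : Type*) where
  | zero : Term A V
  | var : V → Term A V
  | pre : A → Term A V → Term A V
  | add : Term A V → Term A V → Term A V
  | par : Term A V → Term A V → Term A V

namespace Term

variable {A : Type*} {V : Type*}

/-- A term is closed if no variable occurs in it. -/
def Closed : Term A V → Prop
  | zero => True
  | var _ => False
  | pre _ t => Closed t
  | add t u => Closed t ∧ Closed u
  | par t u => Closed t ∧ Closed u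

/-- The action of a substitution `σ` (a map from variables to terms) on a term. -/
def subst (σ : V → Term A V) : Term A V → Term A V
  | zero => zero
  | var x => σ x
  | pre a t => pre a (subst σ t)
  | add t u => add (subst σ t) (subst σ u)
  | par t u => par (subst σ t) (subst σ u)

/-- A substitution is closed if it maps every variable to a closed term. -/
def ClosedSubst (σ : V → Term A V) : Prop := ∀ x, (σ x).Closed

/-- The size of a term: the number of occurrences of the operators `a._`, `+` and `‖` in it.
The constant `0` and the variables are not counted. (Counting `0` gives a larger number, so that
a bound "`N` exceeds the sizes" is least demanding in the present form.) -/
def size : Term A V → ℕ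
  | zero => 0
  | var _ => 0
  | pre _ t => size t + 1
  | add t u => size t + size u + 1
  | par t u => size t + size u + 1

/-- The transition relation given by the operational rules. There is no rule for variables;
a closed term has only transitions to closed terms. -/
inductive Step : Term A V → A → Term A V → Prop
  | pre (a : A) (t : Term A V) : Step (pre a t) a t
  | addLeft {t t' : Term A V} (u : Term A V) {a : A} : Step t a t' → Step (add t u) a t'
  | addRight (t : Term A V) {u u' : Term A V} {a : A} : Step u a u' → Step (add t u) a u'
  | parLeft {t t' : Term A V} (u : Term A V) {a : A} :
      Step t a t' → Step (par t u) a (par t' u)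
  | parRight (t : Term A V) {u u' : Term A V} {a : A} :
      Step u a u' → Step (par t u) a (par t u')

/-- `Steps p α q`: there is a sequence of transitions from `p` to `q` labelled by the word `α`. -/
def Steps : Term A V → List A → Term A V → Prop
  | p, [], q => p = q
  | p, a :: α, q => ∃ r, Step p a r ∧ Steps r α q

/-- The set of traces of `p`. -/
def traces (p : Term A V) : Set (List A) := {α | ∃ p', Steps p α p'}

/-- The set of possible futures of `p`: the pairs `(α, X)` such that `p` can perform `α` and
thereby reach some `p'` whose set of traces is `X`. -/
def possibleFutures (p : Term A V) : Set (List A × Set (List A)) :=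
  {f | ∃ p', Steps p f.1 p' ∧ f.2 = traces p'}

/-- Possible futures equivalence (meant for closed terms; see `Valid` for open ones). -/
def PFEquiv (p q : Term A V) : Prop := possibleFutures p = possibleFutures q

/-- The equation `t ≈ u` is sound modulo the relation `R` on closed terms:
all its closed instances are in `R`. -/
def Valid (R : Term A V → Term A V → Prop) (t u : Term A V) : Prop :=
  ∀ σ : V → Term A V, ClosedSubst σ → R (subst σ t) (subst σ u)

/-- Derivability in equational logic from an axiom system `E`, a set of pairs `(t, u)`
representing the equations `t ≈ u`. -/
inductive Derivable (E : Set (Term A V × Term A V)) : Term A V → Term A V → Prop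
  | ax {t u : Term A V} : (t, u) ∈ E → Derivable E t u
  | refl (t : Term A V) : Derivable E t t
  | symm {t u : Term A V} : Derivable E t u → Derivable E u t
  | trans {t u v : Term A V} : Derivable E t u → Derivable E u v → Derivable E t v
  | subst (σ : V → Term A V) {t u : Term A V} :
      Derivable E t u → Derivable E (subst σ t) (subst σ u)
  | pre (a : A) {t u : Term A V} : Derivable E t u → Derivable E (pre a t) (pre a u)
  | add {t u t' u' : Term A V} :
      Derivable E t u → Derivable E t' u' → Derivable E (add t t') (add u u')
  | par {t u t' u' : Term A V} :
      Derivable E t u → Derivable E t' u' → Derivable E (par t t') (par u u')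

/-- The axiom system `E` is sound modulo `R`. -/
def Sound (R : Term A V → Term A V → Prop) (E : Set (Term A V × Term A V)) : Prop :=
  ∀ t u : Term A V, (t, u) ∈ E → Valid R t u

/-- The axiom system `E` is ground-complete modulo `R`. -/
def GroundComplete (R : Term A V → Term A V → Prop) (E : Set (Term A V × Term A V)) : Prop :=
  ∀ p q : Term A V, p.Closed → q.Closed → R p q → Derivable E p q

/-- `R` has a finite, ground-complete (and sound) equational axiomatisation. -/
def HasFiniteGroundCompleteAxiomatisation (R : Term A V → Term A V → Prop) : Prop :=
  ∃ E : Set (Term A V × Term A V), E.Finite ∧ Sound R E ∧ GroundComplete R E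

/-- The summands of a term: `t` is a sum of its summands, up to occurrences of `0`, and
no summand is `0` or has `+` as head operator. -/
def summands : Term A V → Set (Term A V)
  | zero => ∅
  | var x => {var x}
  | pre a t => {pre a t}
  | add t u => summands t ∪ summands u
  | par t u => {par t u}

/-- `t` has a summand that is possible futures equivalent to `s`. -/
def HasSummandEquiv (t s : Term A V) : Prop := ∃ r ∈ summands t, PFEquiv r s

/-- `t` has no `0` summands and no `0` factors: no subterm of the form `t₁ + t₂` or `t₁ ‖ t₂` has
an argument that is possible futures equivalent to `0`. -/
def NoZero : Term A V → Prop
  | zero => True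
  | var _ => True
  | pre _ t => NoZero t
  | add t u => ¬ Valid PFEquiv t zero ∧ ¬ Valid PFEquiv u zero ∧ NoZero t ∧ NoZero u
  | par t u => ¬ Valid PFEquiv t zero ∧ ¬ Valid PFEquiv u zero ∧ NoZero t ∧ NoZero u

/-- The sum `f 0 + f 1 + ⋯ + f (n - 1)`; it is `0` for `n = 0`. -/
def sum (f : ℕ → Term A V) : ℕ → Term A V
  | 0 => zero
  | 1 => f 0
  | n + 2 => add (sum f (n + 1)) (f (n + 1))

/-- The term `bⁱa`, that is, `b.b.⋯.b.a.0` with `i` occurrences of `b`. -/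
def bPowA (a b : A) : ℕ → Term A V
  | 0 => pre a zero
  | i + 1 => pre b (bPowA a b i)

/-- `p_N = ∑_{i=1}^N bⁱa`. -/
def pN (a b : A) (N : ℕ) : Term A V := sum (fun i => bPowA a b (i + 1)) N

/-- `a ‖ p_N`, the left-hand side of the equation `e_N`. -/
def lhsN (a b : A) (N : ℕ) : Term A V := par (pre a zero) (pN a b N)

/-- `a p_N + ∑_{i=1}^N b(a ‖ b^{i-1}a)`, the right-hand side of the equation `e_N`. -/
def rhsN (a b : A) (N : ℕ) : Term A V :=
  add (pre a (pN a b N)) (sum (fun i => pre b (par (pre a zero) (bPowA a b i))) N)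

end Term

end BCCSP

/-!
The proof exhibits a property of closed terms equivalent to `s = a ‖ p_N` that derivations from a
sound axiom system with terms smaller than `N` preserve, and that separates the two sides of `e_N`:
having a summand equivalent to `s`. In a derivation arbitrary terms may occur, so the property is
stated modulo `0` summands and factors (`HasProperSummand`); for terms without these it is the
property of the theorem (`hasSummandEquiv_iff`). The congruence rules preserve it because possible
futures equivalence is a congruence, and because the possible futures of a summand after nonempty
traces are among those of the whole sum. The essential case is a closed instance `σ(t) ≈ σ(u)` of an
axiom `t ≈ u` (`hasProperSummand_of_valid`).

The summand of `σ(t)` equivalent to `s` comes from a summand of `t`. It is not a prefix, since `s`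
has two initial actions. If it is a variable `x`, then `x` is a summand of `u` too
(`var_mem_properSummands_of_valid`). Otherwise it is some `t₁ ‖ t₂`, and `s` has only one
decomposition (`pfEquiv_factors_lhsN`): up to order `σ(t₁)` is equivalent to `a` and `σ(t₂)` to
`p_N`. A summand of `t₂` that is not a variable accounts for at most one of the `N` summands of
`p_N`, and `t₂` has fewer than `N` summands, so `t₂` has a variable `x` as a summand
(`card_le_size_of_no_var_summand`).

Now let `τ` be `σ` with `x` sent to `bᴹ⁺¹` for a large `M`. Then `τ(t)` has a `b`-transition to a
term with the traces of `a ‖ bᴹ`, and so has `τ(u)`. Counting occurrences of `b` and lengths of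
traces shows that a summand `u₁ ‖ u₂` of `u` makes this transition, by consuming one `b` of a copy
of `bᴹ⁺¹` in one factor, and that the other factor can perform `a` (`source_of_step_probe`,
`exists_par_summand_of_valid`). It is free of `x`, so it can perform `a` under `σ` as well. As
`σ(u)` is equivalent to `s`, unique decomposition applies again and shows that `σ(u₁ ‖ u₂)` is
equivalent to `s`: after the action `a` the term `s` has no other future than the traces of `p_N`.
-/

namespace BCCSP.Term

variable {A V : Type*}

/-! ### Traces and weights of terms -/

/-- The largest total weight of a trace of a term, when the action `c` has weight `f c`.
Variables count as `0`, since they have no transitions. -/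
def weight (f : A → ℕ) : Term A V → ℕ
  | zero => 0
  | var _ => 0
  | pre a t => f a + weight f t
  | add t u => max (weight f t) (weight f u)
  | par t u => weight f t + weight f u

/-- The length of a longest trace. -/
abbrev depth (t : Term A V) : ℕ := weight (fun _ => 1) t

open Classical in
/-- The largest number of occurrences of the action `c` in a trace. -/
noncomputable abbrev maxCount (c : A) (t : Term A V) : ℕ :=
  weight (fun x => if x = c then 1 else 0) t

theorem Step.weight_le {f : A → ℕ} {p p' : Term A V} {c : A} (h : Step p c p') :
    f c + weight f p' ≤ weight f p := by
  induction h with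
  | pre a t => simp [weight]
  | addLeft u _ ih => simp only [weight]; omega
  | addRight t _ ih => simp only [weight]; omega
  | parLeft u _ ih => simp only [weight]; omega
  | parRight t _ ih => simp only [weight]; omega

theorem Steps.weight_le {f : A → ℕ} {α : List A} {p p' : Term A V} (h : Steps p α p') :
    (α.map f).sum + weight f p' ≤ weight f p := by
  induction α generalizing p with
  | nil => cases h; simp
  | cons c α ih =>
    obtain ⟨r, h1, h2⟩ := h
    have := ih h2
    have := h1.weight_le (f := f)
    simp only [List.map_cons, List.sum_cons]
    omega

theorem Steps.trans {α β : List A} {p q r : Term A V} (h : Steps p α q) (h' : Steps q β r) :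
    Steps p (α ++ β) r := by
  induction α generalizing p with
  | nil => cases h; exact h'
  | cons c α ih =>
    obtain ⟨s, h1, h2⟩ := h
    exact ⟨s, h1, ih h2⟩

theorem steps_append {α β : List A} {p r : Term A V} :
    Steps p (α ++ β) r ↔ ∃ q, Steps p α q ∧ Steps q β r := by
  refine ⟨fun h => ?_, fun ⟨q, h1, h2⟩ => h1.trans h2⟩
  induction α generalizing p with
  | nil => exact ⟨p, rfl, h⟩
  | cons c α ih =>
    obtain ⟨s, h1, h2⟩ := h
    obtain ⟨q, h3, h4⟩ := ih h2
    exact ⟨q, ⟨s, h1, h3⟩, h4⟩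

theorem steps_singleton {c : A} {p q : Term A V} : Steps p [c] q ↔ Step p c q := by
  refine ⟨fun ⟨r, h1, h2⟩ => ?_, fun h => ⟨q, h, rfl⟩⟩
  cases h2; exact h1

theorem Steps.addLeft {p q : Term A V} {c : A} {α : List A} (u : Term A V)
    (h : Steps p (c :: α) q) : Steps (add p u) (c :: α) q :=
  let ⟨r, h1, h2⟩ := h; ⟨r, .addLeft u h1, h2⟩

theorem Steps.addRight {p q : Term A V} {c : A} {α : List A} (u : Term A V)
    (h : Steps p (c :: α) q) : Steps (add u p) (c :: α) q :=
  let ⟨r, h1, h2⟩ := h; ⟨r, .addRight u h1, h2⟩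

theorem steps_add {p u q : Term A V} {c : A} {α : List A} :
    Steps (add p u) (c :: α) q ↔ Steps p (c :: α) q ∨ Steps u (c :: α) q := by
  refine ⟨fun ⟨r, h1, h2⟩ => ?_, fun h => h.elim (.addLeft u) (.addRight p)⟩
  cases h1 with
  | addLeft _ h => exact .inl ⟨r, h, h2⟩
  | addRight _ h => exact .inr ⟨r, h, h2⟩

theorem steps_pre {p q : Term A V} {a c : A} {α : List A} :
    Steps (pre a p) (c :: α) q ↔ c = a ∧ Steps p α q := by
  refine ⟨fun ⟨r, h1, h2⟩ => ?_, fun ⟨h, h'⟩ => h ▸ ⟨p, .pre c p, h'⟩⟩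
  cases h1; exact ⟨rfl, h2⟩

/-- `Shuffle β γ α`: the word `α` is an interleaving of the words `β` and `γ`. -/
inductive Shuffle : List A → List A → List A → Prop
  | nil : Shuffle [] [] []
  | left {β γ α : List A} (c : A) : Shuffle β γ α → Shuffle (c :: β) γ (c :: α)
  | right {β γ α : List A} (c : A) : Shuffle β γ α → Shuffle β (c :: γ) (c :: α)

namespace Shuffle

theorem symm {β γ α : List A} (h : Shuffle β γ α) : Shuffle γ β α := by
  induction h with
  | nil => exact .nil
  | left c _ ih => exact .right c ih
  | right c _ ih => exact .left c ih

theorem nil_left (γ : List A) : Shuffle [] γ γ := by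
  induction γ with
  | nil => exact .nil
  | cons c γ ih => exact .right c ih

theorem append_left {β γ α : List A} (h : Shuffle β γ α) (δ : List A) :
    Shuffle (δ ++ β) γ (δ ++ α) := by
  induction δ with
  | nil => exact h
  | cons c δ ih => exact .left c ih

theorem append (β γ : List A) : Shuffle β γ (β ++ γ) := by
  simpa using (nil_left γ).append_left β

theorem eq_of_nil_left {γ α : List A} (h : Shuffle [] γ α) : α = γ := by
  generalize hβ : ([] : List A) = β at h
  induction h with
  | nil => rfl
  | left c _ ih => cases hβ
  | right c _ ih => rw [ih hβ]

theorem perm {β γ α : List A} (h : Shuffle β γ α) : α.Perm (β ++ γ) := by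
  induction h with
  | nil => rfl
  | left c _ ih => exact ih.cons c
  | right c _ ih => exact (ih.cons c).trans List.perm_middle.symm

end Shuffle

theorem steps_par {p q v : Term A V} {α : List A} :
    Steps (par p q) α v ↔
      ∃ β γ p' q', Shuffle β γ α ∧ Steps p β p' ∧ Steps q γ q' ∧ v = par p' q' := by
  constructor
  · intro h
    induction α generalizing p q with
    | nil => cases h; exact ⟨[], [], p, q, .nil, rfl, rfl, rfl⟩
    | cons c α ih =>
      obtain ⟨r, h1, h2⟩ := h
      cases h1 with
      | parLeft _ h =>
        obtain ⟨β, γ, p', q', hs, hp, hq, rfl⟩ := ih h2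
        exact ⟨c :: β, γ, p', q', .left c hs, ⟨_, h, hp⟩, hq, rfl⟩
      | parRight _ h =>
        obtain ⟨β, γ, p', q', hs, hp, hq, rfl⟩ := ih h2
        exact ⟨β, c :: γ, p', q', .right c hs, hp, ⟨_, h, hq⟩, rfl⟩
  · rintro ⟨β, γ, p', q', hs, hp, hq, rfl⟩
    induction hs generalizing p q with
    | nil => cases hp; cases hq; rfl
    | left c _ ih =>
      obtain ⟨r, h1, h2⟩ := hp
      exact ⟨_, .parLeft q h1, ih h2 hq⟩
    | right c _ ih =>
      obtain ⟨r, h1, h2⟩ := hq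
      exact ⟨_, .parRight p h1, ih hp h2⟩

theorem mem_traces_par {p q : Term A V} {α : List A} :
    α ∈ traces (par p q) ↔ ∃ β ∈ traces p, ∃ γ ∈ traces q, Shuffle β γ α := by
  constructor
  · rintro ⟨v, h⟩
    obtain ⟨β, γ, p', q', hs, hp, hq, -⟩ := steps_par.1 h
    exact ⟨β, ⟨p', hp⟩, γ, ⟨q', hq⟩, hs⟩
  · rintro ⟨β, ⟨p', hp⟩, γ, ⟨q', hq⟩, hs⟩
    exact ⟨_, steps_par.2 ⟨β, γ, p', q', hs, hp, hq, rfl⟩⟩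

theorem nil_mem_traces (p : Term A V) : [] ∈ traces p := ⟨p, rfl⟩

theorem mem_traces_of_append {p : Term A V} {α β : List A} (h : α ++ β ∈ traces p) :
    α ∈ traces p := by
  obtain ⟨r, h⟩ := h
  obtain ⟨q, h1, -⟩ := steps_append.1 h
  exact ⟨q, h1⟩

theorem exists_trace_weight (f : A → ℕ) (p : Term A V) :
    ∃ α ∈ traces p, (α.map f).sum = weight f p := by
  induction p with
  | zero => exact ⟨[], nil_mem_traces _, rfl⟩
  | var x => exact ⟨[], nil_mem_traces _, rfl⟩
  | pre a t ih =>
    obtain ⟨α, ⟨t', h⟩, hα⟩ := ih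
    exact ⟨a :: α, ⟨t', steps_pre.2 ⟨rfl, h⟩⟩, by simp [weight, hα]⟩
  | add t u iht ihu =>
    rcases le_total (weight f t) (weight f u) with hle | hle
    · obtain ⟨α, ⟨u', h⟩, hα⟩ := ihu
      rcases α with _ | ⟨c, α⟩
      · exact ⟨[], nil_mem_traces _, by simpa [weight, hle] using hα⟩
      · exact ⟨_, ⟨u', h.addRight t⟩, by simp only [weight, hα, max_eq_right hle]⟩
    · obtain ⟨α, ⟨t', h⟩, hα⟩ := iht
      rcases α with _ | ⟨c, α⟩
      · exact ⟨[], nil_mem_traces _, by simpa [weight, hle] using hα⟩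
      · exact ⟨_, ⟨t', h.addLeft u⟩, by simp only [weight, hα, max_eq_left hle]⟩
  | par t u iht ihu =>
    obtain ⟨α, hα, hα'⟩ := iht
    obtain ⟨β, hβ, hβ'⟩ := ihu
    exact ⟨α ++ β, mem_traces_par.2 ⟨α, hα, β, hβ, .append α β⟩, by simp [weight, hα', hβ']⟩

theorem sum_le_weight (f : A → ℕ) {p : Term A V} {α : List A} (h : α ∈ traces p) :
    (α.map f).sum ≤ weight f p := by
  obtain ⟨p', h⟩ := h
  exact (Nat.le_add_right _ _).trans h.weight_le

theorem weight_le_of_traces_subset (f : A → ℕ) {p q : Term A V} (h : traces p ⊆ traces q) :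
    weight f p ≤ weight f q := by
  obtain ⟨α, hα, e⟩ := exists_trace_weight f p
  exact e ▸ sum_le_weight f (h hα)

theorem weight_congr (f : A → ℕ) {p q : Term A V} (h : traces p = traces q) :
    weight f p = weight f q :=
  le_antisymm (weight_le_of_traces_subset f h.le) (weight_le_of_traces_subset f h.ge)

theorem depth_pos_iff {p : Term A V} : 0 < depth p ↔ ∃ c p', Step p c p' := by
  constructor
  · intro h
    obtain ⟨α, ⟨p', hα⟩, e⟩ := exists_trace_weight (fun _ => 1) p
    rcases α with _ | ⟨c, α⟩
    · exact absurd h (by rw [depth, ← e]; simp)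
    · obtain ⟨r, hr, -⟩ := hα
      exact ⟨c, r, hr⟩
  · rintro ⟨c, p', h⟩
    have := h.weight_le (f := fun _ => 1)
    simp only [depth]
    omega

theorem eq_nil_of_depth_eq_zero {p : Term A V} (hp : depth p = 0) {α : List A}
    (h : α ∈ traces p) : α = [] := by
  have := sum_le_weight (fun _ => 1) h
  rw [show weight (fun _ => 1) p = 0 from hp] at this
  simpa using this

open Classical in
theorem exists_trace_mem {a : A} {p : Term A V} (h : 0 < maxCount a p) :
    ∃ α ∈ traces p, a ∈ α := by
  obtain ⟨α, hα, e⟩ := exists_trace_weight (fun x => if x = a then 1 else 0) p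
  refine ⟨α, hα, ?_⟩
  by_contra hn
  have : weight (fun x => if x = a then 1 else 0) p = 0 := by
    rw [← e]
    refine List.sum_eq_zero fun n hn' => ?_
    obtain ⟨x, hx, rfl⟩ := List.mem_map.1 hn'
    exact if_neg fun hxa : x = a => hn (hxa ▸ hx)
  exact absurd h (by rw [maxCount]; exact this.not_gt)

theorem maxCount_pos_of_mem {a : A} {p : Term A V} {α : List A} (h : α ∈ traces p) (ha : a ∈ α) :
    0 < maxCount a p := by
  refine lt_of_lt_of_le ?_ (sum_le_weight _ h)
  refine List.sum_pos_iff_exists_pos_nat.2 ⟨1, List.mem_map.2 ⟨a, ha, if_pos rfl⟩, one_pos⟩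

/-! ### Possible futures -/

/-- Inclusion of possible futures. -/
def PFLe (p q : Term A V) : Prop :=
  ∀ α p', Steps p α p' → ∃ q', Steps q α q' ∧ traces q' = traces p'

/-- Inclusion of the possible futures after nonempty traces. A summand `p` of `q` is related to `q`
in this way, although its trace set, its future after the empty trace, may be a smaller one. -/
def ProperPFLe (p q : Term A V) : Prop :=
  ∀ c α p', Steps p (c :: α) p' → ∃ q', Steps q (c :: α) q' ∧ traces q' = traces p'

theorem pfLe_iff {p q : Term A V} : PFLe p q ↔ traces p = traces q ∧ ProperPFLe p q := by
  constructor
  · intro h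
    obtain ⟨q', h1, h2⟩ := h [] p rfl
    cases h1
    exact ⟨h2.symm, fun c α => h (c :: α)⟩
  · rintro ⟨h1, h2⟩ (_ | ⟨c, α⟩) p' hp
    · cases hp; exact ⟨q, rfl, h1.symm⟩
    · exact h2 c α p' hp

theorem pfEquiv_iff {p q : Term A V} : PFEquiv p q ↔ PFLe p q ∧ PFLe q p := by
  constructor
  · intro h
    constructor
    · intro α p' hp
      obtain ⟨q', h1, h2⟩ := (Set.ext_iff.1 h (α, traces p')).1 ⟨p', hp, rfl⟩
      exact ⟨q', h1, h2.symm⟩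
    · intro α q' hq
      obtain ⟨p', h1, h2⟩ := (Set.ext_iff.1 h (α, traces q')).2 ⟨q', hq, rfl⟩
      exact ⟨p', h1, h2.symm⟩
  · rintro ⟨h1, h2⟩
    refine Set.Subset.antisymm ?_ ?_
    · rintro ⟨α, X⟩ ⟨p', hp, rfl⟩
      obtain ⟨q', hq, e⟩ := h1 α p' hp
      exact ⟨q', hq, e.symm⟩
    · rintro ⟨α, X⟩ ⟨p', hp, rfl⟩
      obtain ⟨q', hq, e⟩ := h2 α p' hp
      exact ⟨q', hq, e.symm⟩

theorem PFEquiv.traces_eq {p q : Term A V} (h : PFEquiv p q) : traces p = traces q :=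
  (pfLe_iff.1 (pfEquiv_iff.1 h).1).1

theorem PFEquiv.properPFLe {p q : Term A V} (h : PFEquiv p q) : ProperPFLe p q :=
  (pfLe_iff.1 (pfEquiv_iff.1 h).1).2

theorem PFEquiv.of_proper {p q : Term A V} (h : traces p = traces q) (h1 : ProperPFLe p q)
    (h2 : ProperPFLe q p) : PFEquiv p q :=
  pfEquiv_iff.2 ⟨pfLe_iff.2 ⟨h, h1⟩, pfLe_iff.2 ⟨h.symm, h2⟩⟩

theorem PFEquiv.refl (p : Term A V) : PFEquiv p p := rfl

theorem PFEquiv.symm {p q : Term A V} (h : PFEquiv p q) : PFEquiv q p := Eq.symm h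

theorem PFEquiv.trans {p q r : Term A V} (h : PFEquiv p q) (h' : PFEquiv q r) : PFEquiv p r :=
  Eq.trans h h'

theorem ProperPFLe.refl (p : Term A V) : ProperPFLe p p := fun _ _ p' h => ⟨p', h, rfl⟩

theorem ProperPFLe.trans {p q r : Term A V} (h : ProperPFLe p q) (h' : ProperPFLe q r) :
    ProperPFLe p r := by
  intro c α p' hp
  obtain ⟨q', hq, e⟩ := h c α p' hp
  obtain ⟨r', hr, e'⟩ := h' c α q' hq
  exact ⟨r', hr, e'.trans e⟩

theorem ProperPFLe.traces_subset {p q : Term A V} (h : ProperPFLe p q) : traces p ⊆ traces q := by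
  rintro (_ | ⟨c, α⟩) ⟨p', hp⟩
  · exact nil_mem_traces q
  · obtain ⟨q', hq, -⟩ := h c α p' hp
    exact ⟨q', hq⟩

theorem ProperPFLe.exists_step {p q p' : Term A V} {c : A} (h : ProperPFLe p q)
    (hp : Step p c p') : ∃ q', Step q c q' ∧ traces q' = traces p' := by
  obtain ⟨q', h1, h2⟩ := h c [] p' (steps_singleton.2 hp)
  exact ⟨q', steps_singleton.1 h1, h2⟩

theorem ProperPFLe.of_step {p q : Term A V}
    (h : ∀ c p', Step p c p' → ∃ q', Step q c q' ∧ PFEquiv p' q') : ProperPFLe p q := by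
  rintro c α p' ⟨r, h1, h2⟩
  obtain ⟨q', hq, e⟩ := h c r h1
  obtain ⟨q'', h3, h4⟩ := (pfEquiv_iff.1 e).1 α p' h2
  exact ⟨q'', ⟨q', hq, h3⟩, h4⟩

theorem PFEquiv.of_step {p q : Term A V}
    (h1 : ∀ c p', Step p c p' → ∃ q', Step q c q' ∧ PFEquiv p' q')
    (h2 : ∀ c q', Step q c q' → ∃ p', Step p c p' ∧ PFEquiv q' p') : PFEquiv p q := by
  have h1' := ProperPFLe.of_step h1
  have h2' := ProperPFLe.of_step h2
  exact .of_proper (h1'.traces_subset.antisymm h2'.traces_subset) h1' h2'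

theorem traces_par_congr {p q p' q' : Term A V} (h : traces p = traces p')
    (h' : traces q = traces q') : traces (par p q) = traces (par p' q') := by
  ext α
  simp only [mem_traces_par, h, h']

theorem PFEquiv.pre (a : A) {p q : Term A V} (h : PFEquiv p q) :
    PFEquiv (pre a p) (pre a q) := by
  refine .of_step ?_ ?_
  · rintro c r hr; cases hr; exact ⟨q, .pre _ _, h⟩
  · rintro c r hr; cases hr; exact ⟨p, .pre _ _, h.symm⟩

theorem ProperPFLe.add {p q p' q' : Term A V} (h : ProperPFLe p p') (h' : ProperPFLe q q') :
    ProperPFLe (add p q) (add p' q') := by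
  intro c α r hr
  rcases steps_add.1 hr with hr | hr
  · obtain ⟨r', h1, h2⟩ := h c α r hr
    exact ⟨r', h1.addLeft q', h2⟩
  · obtain ⟨r', h1, h2⟩ := h' c α r hr
    exact ⟨r', h1.addRight p', h2⟩

theorem PFEquiv.add {p q p' q' : Term A V} (h : PFEquiv p p') (h' : PFEquiv q q') :
    PFEquiv (add p q) (add p' q') := by
  have h1 := h.properPFLe.add h'.properPFLe
  have h2 := h.symm.properPFLe.add h'.symm.properPFLe
  exact .of_proper (h1.traces_subset.antisymm h2.traces_subset) h1 h2

theorem PFLe.par {p q p' q' : Term A V} (h : PFLe p p') (h' : PFLe q q') :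
    PFLe (par p q) (par p' q') := by
  intro α r hr
  obtain ⟨β, γ, p1, q1, hs, hp, hq, rfl⟩ := steps_par.1 hr
  obtain ⟨p2, hp2, ep⟩ := h β p1 hp
  obtain ⟨q2, hq2, eq⟩ := h' γ q1 hq
  exact ⟨_, steps_par.2 ⟨β, γ, p2, q2, hs, hp2, hq2, rfl⟩, traces_par_congr ep eq⟩

theorem PFEquiv.par {p q p' q' : Term A V} (h : PFEquiv p p') (h' : PFEquiv q q') :
    PFEquiv (par p q) (par p' q') := by
  rw [pfEquiv_iff] at *
  exact ⟨h.1.par h'.1, h.2.par h'.2⟩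

theorem traces_par_comm (p q : Term A V) : traces (par p q) = traces (par q p) := by
  ext α
  simp only [mem_traces_par]
  exact ⟨fun ⟨β, h1, γ, h2, h⟩ => ⟨γ, h2, β, h1, h.symm⟩,
    fun ⟨β, h1, γ, h2, h⟩ => ⟨γ, h2, β, h1, h.symm⟩⟩

theorem pfLe_par_comm (p q : Term A V) : PFLe (par p q) (par q p) := by
  intro α r hr
  obtain ⟨β, γ, p1, q1, hs, hp, hq, rfl⟩ := steps_par.1 hr
  exact ⟨_, steps_par.2 ⟨γ, β, q1, p1, hs.symm, hq, hp, rfl⟩, traces_par_comm _ _⟩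

theorem pfEquiv_par_comm (p q : Term A V) : PFEquiv (par p q) (par q p) :=
  pfEquiv_iff.2 ⟨pfLe_par_comm p q, pfLe_par_comm q p⟩

theorem traces_par_of_depth_eq_zero {p : Term A V} (hp : depth p = 0) (q : Term A V) :
    traces (par p q) = traces q := by
  ext α
  rw [mem_traces_par]
  constructor
  · rintro ⟨β, hβ, γ, hγ, hs⟩
    obtain rfl := eq_nil_of_depth_eq_zero hp hβ
    exact hs.eq_of_nil_left ▸ hγ
  · exact fun h => ⟨[], nil_mem_traces p, α, h, .nil_left α⟩

theorem pfEquiv_par_of_depth_eq_zero {p : Term A V} (hp : depth p = 0) (q : Term A V) :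
    PFEquiv (par p q) q := by
  refine pfEquiv_iff.2 ⟨fun α r hr => ?_, fun α r hr => ?_⟩
  · obtain ⟨β, γ, p1, q1, hs, hp1, hq, rfl⟩ := steps_par.1 hr
    obtain rfl := eq_nil_of_depth_eq_zero hp ⟨p1, hp1⟩
    cases hp1
    exact ⟨q1, hs.eq_of_nil_left ▸ hq, (traces_par_of_depth_eq_zero hp q1).symm⟩
  · exact ⟨_, steps_par.2 ⟨[], α, p, r, .nil_left α, rfl, hr, rfl⟩,
      traces_par_of_depth_eq_zero hp r⟩

theorem pfEquiv_par_of_depth_eq_zero_right {q : Term A V} (hq : depth q = 0) (p : Term A V) :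
    PFEquiv (par p q) p :=
  (pfEquiv_par_comm p q).trans (pfEquiv_par_of_depth_eq_zero hq p)

theorem pfEquiv_zero_iff {p : Term A V} : PFEquiv p zero ↔ depth p = 0 := by
  constructor
  · exact fun h => weight_congr _ h.traces_eq
  · intro h
    refine .of_step (fun c p' hp => ?_) (fun c p' hp => nomatch hp)
    exact absurd (depth_pos_iff.2 ⟨c, p', hp⟩) (by omega)

/-! ### Substitutions and occurrences of variables -/

theorem Closed.subst_eq {p : Term A V} (h : p.Closed) (σ : V → Term A V) : subst σ p = p := by
  induction p with
  | zero => rfl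
  | var x => exact h.elim
  | pre a t ih => simp only [subst, ih h]
  | add t u iht ihu => simp only [subst, iht h.1, ihu h.2]
  | par t u iht ihu => simp only [subst, iht h.1, ihu h.2]

theorem subst_var (p : Term A V) : subst var p = p := by
  induction p <;> simp_all [subst]

theorem subst_subst (σ τ : V → Term A V) (p : Term A V) :
    subst τ (subst σ p) = subst (fun x => subst τ (σ x)) p := by
  induction p <;> simp_all [subst]

theorem Closed.subst {σ : V → Term A V} (hσ : ClosedSubst σ) (t : Term A V) :
    (subst σ t).Closed := by
  induction t with
  | zero => trivial
  | var x => exact hσ x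
  | pre a t ih => exact ih
  | add t u iht ihu => exact ⟨iht, ihu⟩
  | par t u iht ihu => exact ⟨iht, ihu⟩

/-- The variable `x` occurs in the term. -/
def Occurs (x : V) : Term A V → Prop
  | zero => False
  | var y => y = x
  | pre _ t => Occurs x t
  | add t u => Occurs x t ∨ Occurs x u
  | par t u => Occurs x t ∨ Occurs x u

theorem Occurs.weight_le {x : V} {t : Term A V} (h : Occurs x t) (f : A → ℕ) (σ : V → Term A V) :
    weight f (σ x) ≤ weight f (subst σ t) := by
  induction t with
  | zero => exact h.elim
  | var y => cases h; rfl
  | pre a t ih => have := ih h; simp only [subst, weight]; omega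
  | add t u iht ihu =>
    simp only [subst, weight]
    exact h.elim (fun h => (iht h).trans (le_max_left _ _)) fun h => (ihu h).trans (le_max_right _ _)
  | par t u iht ihu =>
    simp only [subst, weight]
    rcases h with h | h
    · have := iht h; omega
    · have := ihu h; omega

open Classical in
theorem subst_update_of_not_occurs {x : V} {t : Term A V} (h : ¬ Occurs x t) (σ : V → Term A V)
    (s : Term A V) : subst (Function.update σ x s) t = subst σ t := by
  induction t with
  | zero => rfl
  | var y => exact Function.update_of_ne h _ _
  | pre a t ih => simp only [subst, ih h]
  | add t u iht ihu => simp only [subst, iht (fun h' => h (.inl h')), ihu (fun h' => h (.inr h'))]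
  | par t u iht ihu => simp only [subst, iht (fun h' => h (.inl h')), ihu (fun h' => h (.inr h'))]

/-! ### The terms `bⁱa`, `p_N` and `a ‖ p_N` -/

theorem steps_pre_zero {a : A} {α : List A} {r : Term A V} :
    Steps (pre a zero) α r ↔ (α = [] ∧ r = pre a zero) ∨ (α = [a] ∧ r = zero) := by
  constructor
  · intro h
    rcases α with _ | ⟨c, α⟩
    · cases h; exact .inl ⟨rfl, rfl⟩
    · obtain ⟨rfl, h'⟩ := steps_pre.1 h
      rcases α with _ | ⟨d, α⟩
      · exact .inr ⟨rfl, h'.symm⟩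
      · exact nomatch h'.choose_spec.1
  · rintro (⟨rfl, rfl⟩ | ⟨rfl, rfl⟩)
    · rfl
    · exact ⟨zero, .pre _ _, rfl⟩

theorem steps_bPowA_replicate {a b : A} (hab : a ≠ b) {m n : ℕ} {r : Term A V} :
    Steps (bPowA a b m) (List.replicate n b) r ↔ ∃ k, m = k + n ∧ r = bPowA a b k := by
  induction n generalizing m with
  | zero =>
    constructor
    · intro h; cases h; exact ⟨m, rfl, rfl⟩
    · rintro ⟨k, rfl, rfl⟩; rfl
  | succ n ih =>
    rcases m with _ | m
    · constructor
      · intro h; exact absurd (steps_pre.1 h).1.symm hab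
      · rintro ⟨k, hk, -⟩; omega
    · constructor
      · intro h
        obtain ⟨k, hk, hr⟩ := ih.1 (steps_pre.1 h).2
        exact ⟨k, by omega, hr⟩
      · rintro ⟨k, hk, hr⟩
        exact steps_pre.2 ⟨rfl, ih.2 ⟨k, by omega, hr⟩⟩

theorem mem_traces_bPowA {a b : A} {k : ℕ} {α : List A} :
    α ∈ traces (bPowA a b k : Term A V) ↔
      (∃ n ≤ k, α = List.replicate n b) ∨ α = List.replicate k b ++ [a] := by
  induction k generalizing α with
  | zero =>
    constructor
    · rintro ⟨r, h⟩
      rcases steps_pre_zero.1 h with ⟨rfl, -⟩ | ⟨rfl, -⟩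
      · exact .inl ⟨0, le_rfl, rfl⟩
      · exact .inr rfl
    · rintro (⟨n, hn, rfl⟩ | rfl)
      · obtain rfl := Nat.le_zero.1 hn
        exact nil_mem_traces _
      · exact ⟨zero, steps_pre_zero.2 (.inr ⟨rfl, rfl⟩)⟩
  | succ k ih =>
    rcases α with _ | ⟨c, α⟩
    · exact iff_of_true (nil_mem_traces _) (.inl ⟨0, Nat.zero_le _, rfl⟩)
    · constructor
      · rintro ⟨r, h⟩
        obtain ⟨rfl, h⟩ := steps_pre.1 h
        rcases ih.1 ⟨r, h⟩ with ⟨n, hn, rfl⟩ | rfl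
        · exact .inl ⟨n + 1, by omega, rfl⟩
        · exact .inr rfl
      · rintro (⟨n, hn, h⟩ | h)
        · rcases n with _ | n
          · cases h
          · obtain ⟨rfl, rfl⟩ := List.cons.inj h
            obtain ⟨r, hr⟩ := ih.2 (.inl ⟨n, by omega, rfl⟩)
            exact ⟨r, steps_pre.2 ⟨rfl, hr⟩⟩
        · obtain ⟨rfl, rfl⟩ := List.cons.inj h
          obtain ⟨r, hr⟩ := ih.2 (.inr rfl)
          exact ⟨r, steps_pre.2 ⟨rfl, hr⟩⟩

theorem step_sum {f : ℕ → Term A V} {n : ℕ} {c : A} {r : Term A V} :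
    Step (sum f n) c r ↔ ∃ i < n, Step (f i) c r := by
  match n with
  | 0 => exact iff_of_false nofun (by simp)
  | 1 => simp [sum]
  | n + 2 =>
    have ih := step_sum (f := f) (n := n + 1) (c := c) (r := r)
    constructor
    · intro h
      cases h with
      | addLeft _ h =>
        obtain ⟨i, hi, h⟩ := ih.1 h
        exact ⟨i, by omega, h⟩
      | addRight _ h => exact ⟨n + 1, by omega, h⟩
    · rintro ⟨i, hi, h⟩
      rcases Nat.lt_succ_iff_lt_or_eq.1 hi with hi | rfl
      · exact .addLeft _ (ih.2 ⟨i, hi, h⟩)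
      · exact .addRight _ h

theorem step_pN {a b c : A} {N : ℕ} {r : Term A V} :
    Step (pN a b N) c r ↔ c = b ∧ ∃ k < N, r = bPowA a b k := by
  rw [pN, step_sum]
  constructor
  · rintro ⟨i, hi, h⟩; cases h; exact ⟨rfl, i, hi, rfl⟩
  · rintro ⟨rfl, i, hi, rfl⟩; exact ⟨i, hi, .pre _ _⟩

theorem steps_pN_replicate {a b : A} (hab : a ≠ b) {N n : ℕ} {r : Term A V} :
    Steps (pN a b N) (List.replicate (n + 1) b) r ↔ ∃ k, k + n < N ∧ r = bPowA a b k := by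
  constructor
  · rintro ⟨q, h1, h2⟩
    obtain ⟨-, m, hm, rfl⟩ := step_pN.1 h1
    obtain ⟨k, rfl, rfl⟩ := (steps_bPowA_replicate hab).1 h2
    exact ⟨k, hm, rfl⟩
  · rintro ⟨k, hk, rfl⟩
    exact ⟨_, step_pN.2 ⟨rfl, _, hk, rfl⟩, (steps_bPowA_replicate hab).2 ⟨k, rfl, rfl⟩⟩

theorem cons_mem_traces_pN {a b c : A} {N : ℕ} {α : List A} :
    c :: α ∈ traces (pN a b N : Term A V) ↔
      (∃ n < N, c :: α = List.replicate (n + 1) b) ∨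
        ∃ n < N, c :: α = List.replicate (n + 1) b ++ [a] := by
  constructor
  · rintro ⟨r, q, h1, h2⟩
    obtain ⟨rfl, m, hm, rfl⟩ := step_pN.1 h1
    rcases mem_traces_bPowA.1 ⟨r, h2⟩ with ⟨n, hn, rfl⟩ | rfl
    · exact .inl ⟨n, by omega, rfl⟩
    · exact .inr ⟨m, hm, rfl⟩
  · rintro (⟨n, hn, h⟩ | ⟨n, hn, h⟩) <;> obtain ⟨rfl, rfl⟩ := List.cons.inj h
    · obtain ⟨r, hr⟩ := mem_traces_bPowA (a := a) (V := V).2 (.inl ⟨n, le_rfl, rfl⟩)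
      exact ⟨r, _, step_pN.2 ⟨rfl, n, hn, rfl⟩, hr⟩
    · obtain ⟨r, hr⟩ := mem_traces_bPowA (V := V).2 (.inr rfl)
      exact ⟨r, _, step_pN.2 ⟨rfl, n, hn, rfl⟩, hr⟩

/-- Every action of the word `bⁱa` is `b`, except the last. -/
theorem not_mem_init_bPowA {a b c : A} (hab : a ≠ b) {k : ℕ} {α : List A}
    (h : α ++ [c] ∈ traces (bPowA a b k : Term A V)) : a ∉ α := by
  rcases mem_traces_bPowA.1 h with ⟨n, hn, h⟩ | h
  · exact fun ha => hab (List.eq_of_mem_replicate (h ▸ List.mem_append_left [c] ha))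
  · rw [(List.append_inj' h rfl).1]
    exact fun ha => hab (List.eq_of_mem_replicate ha)

theorem not_mem_init_pN {a b c : A} (hab : a ≠ b) {N : ℕ} {α : List A}
    (h : α ++ [c] ∈ traces (pN a b N : Term A V)) : a ∉ α := by
  rcases α with _ | ⟨d, α⟩
  · simp
  · obtain ⟨r, q, h1, h2⟩ := h
    obtain ⟨rfl, m, hm, rfl⟩ := step_pN.1 h1
    exact List.not_mem_cons_of_ne_of_not_mem hab (not_mem_init_bPowA hab ⟨r, h2⟩)

theorem maxCount_left_bPowA {a b : A} (hab : a ≠ b) (k : ℕ) :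
    maxCount a (bPowA a b k : Term A V) = 1 := by
  induction k with
  | zero => simp [bPowA, weight]
  | succ k ih => simpa [bPowA, weight, hab.symm] using ih

theorem maxCount_right_bPowA {a b : A} (hab : a ≠ b) (k : ℕ) :
    maxCount b (bPowA a b k : Term A V) = k := by
  induction k with
  | zero => simp [bPowA, weight, hab]
  | succ k ih =>
    have : maxCount b (bPowA a b (k + 1) : Term A V) = 1 + maxCount b (bPowA a b k : Term A V) := by
      simp [bPowA, weight]
    omega

theorem weight_sum_le {f : A → ℕ} {g : ℕ → Term A V} {n B : ℕ} (h : ∀ i < n, weight f (g i) ≤ B) :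
    weight f (sum g n) ≤ B := by
  match n with
  | 0 => exact Nat.zero_le _
  | 1 => exact h 0 one_pos
  | n + 2 =>
    exact max_le (weight_sum_le fun i hi => h i (by omega)) (h (n + 1) (by omega))

theorem le_weight_sum {f : A → ℕ} {g : ℕ → Term A V} {n i : ℕ} (hi : i < n) :
    weight f (g i) ≤ weight f (sum g n) := by
  match n with
  | 0 => omega
  | 1 => obtain rfl : i = 0 := by omega
         exact le_rfl
  | n + 2 =>
    rcases Nat.lt_succ_iff_lt_or_eq.1 hi with hi | rfl
    · exact (le_weight_sum hi).trans (le_max_left _ _)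
    · exact le_max_right _ _

theorem maxCount_left_pN {a b : A} (hab : a ≠ b) {N : ℕ} (hN : 1 ≤ N) :
    maxCount a (pN a b N : Term A V) = 1 :=
  le_antisymm (weight_sum_le fun i _ => (maxCount_left_bPowA hab (i + 1)).le)
    ((maxCount_left_bPowA hab (0 + 1)).ge.trans
      (le_weight_sum (g := fun i => bPowA a b (i + 1)) hN))

theorem maxCount_right_pN {a b : A} (hab : a ≠ b) {N : ℕ} (hN : 1 ≤ N) :
    maxCount b (pN a b N : Term A V) = N := by
  refine le_antisymm (weight_sum_le fun i hi => (maxCount_right_bPowA hab (i + 1)).trans_le hi) ?_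
  have := le_weight_sum (V := V) (f := fun x => by classical exact if x = b then 1 else 0)
    (g := fun i => bPowA a b (i + 1)) (n := N) (i := N - 1) (by omega)
  have h := maxCount_right_bPowA (V := V) hab (N - 1 + 1)
  have h' : N - 1 + 1 = N := by omega
  exact (h'.symm.trans h.symm).le.trans this

theorem step_lhsN {a b c : A} {N : ℕ} {r : Term A V} :
    Step (lhsN a b N) c r ↔ (c = a ∧ r = par zero (pN a b N)) ∨
      (c = b ∧ ∃ k < N, r = par (pre a zero) (bPowA a b k)) := by
  constructor
  · intro h
    cases h with
    | parLeft _ h => cases h; exact .inl ⟨rfl, rfl⟩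
    | parRight _ h =>
      obtain ⟨rfl, k, hk, rfl⟩ := step_pN.1 h
      exact .inr ⟨rfl, k, hk, rfl⟩
  · rintro (⟨rfl, rfl⟩ | ⟨rfl, k, hk, rfl⟩)
    · exact .parLeft _ (.pre _ _)
    · exact .parRight _ (step_pN.2 ⟨rfl, k, hk, rfl⟩)

theorem step_rhsN {a b c : A} {N : ℕ} {r : Term A V} :
    Step (rhsN a b N) c r ↔ (c = a ∧ r = pN a b N) ∨
      (c = b ∧ ∃ k < N, r = par (pre a zero) (bPowA a b k)) := by
  constructor
  · intro h
    cases h with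
    | addLeft _ h => cases h; exact .inl ⟨rfl, rfl⟩
    | addRight _ h =>
      obtain ⟨k, hk, h⟩ := step_sum.1 h
      cases h
      exact .inr ⟨rfl, k, hk, rfl⟩
  · rintro (⟨rfl, rfl⟩ | ⟨rfl, k, hk, rfl⟩)
    · exact .addLeft _ (.pre _ _)
    · exact .addRight _ (step_sum.2 ⟨k, hk, .pre _ _⟩)

theorem pfEquiv_lhsN_rhsN (a b : A) (N : ℕ) :
    PFEquiv (lhsN a b N : Term A V) (rhsN a b N) := by
  have h0 : PFEquiv (par zero (pN a b N) : Term A V) (pN a b N) :=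
    pfEquiv_par_of_depth_eq_zero rfl _
  refine .of_step (fun c r h => ?_) (fun c r h => ?_)
  · rcases step_lhsN.1 h with ⟨rfl, rfl⟩ | ⟨rfl, h⟩
    · exact ⟨_, step_rhsN.2 (.inl ⟨rfl, rfl⟩), h0⟩
    · exact ⟨r, step_rhsN.2 (.inr ⟨rfl, h⟩), .refl r⟩
  · rcases step_rhsN.1 h with ⟨rfl, rfl⟩ | ⟨rfl, h⟩
    · exact ⟨_, step_lhsN.2 (.inl ⟨rfl, rfl⟩), h0.symm⟩
    · exact ⟨r, step_lhsN.2 (.inr ⟨rfl, h⟩), .refl r⟩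

/-- A term that is prefixed has one initial action, whereas `a ‖ p_N` has two. -/
theorem not_pfEquiv_pre_lhsN {a b c : A} (hab : a ≠ b) {N : ℕ} (hN : 1 ≤ N) (t : Term A V) :
    ¬ PFEquiv (pre c t) (lhsN a b N) := by
  intro h
  obtain ⟨_, h1, -⟩ := h.symm.properPFLe.exists_step (step_lhsN.2 (.inl ⟨rfl, rfl⟩))
  obtain ⟨_, h2, -⟩ := h.symm.properPFLe.exists_step (step_lhsN.2 (.inr ⟨rfl, 0, hN, rfl⟩))
  cases h1
  cases h2
  exact hab rfl

/-! ### Unique decomposition of `a ‖ p_N` -/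

/-- If no trace of `p ‖ q` continues after the action `a`, and `p` can perform `a`, then `q` can do
nothing. -/
theorem depth_eq_zero_of_par {a : A} {p q : Term A V}
    (H : ∀ α c, α ++ [c] ∈ traces (par p q) → a ∉ α) (hp : 0 < maxCount a p) : depth q = 0 := by
  by_contra hq
  obtain ⟨c, q', hq'⟩ := depth_pos_iff.1 (Nat.pos_of_ne_zero hq)
  obtain ⟨α, hα, ha⟩ := exists_trace_mem hp
  exact H α c (mem_traces_par.2 ⟨α, hα, [c], ⟨q', steps_singleton.2 hq'⟩, .append α [c]⟩) ha

/-- Cancellation of the factor `a`. -/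
theorem traces_eq_of_par_pre {a b : A} (hab : a ≠ b) {q : Term A V} {k : ℕ}
    (hq : ∀ α ∈ traces q, ∃ m, α = List.replicate m b ∨ α = List.replicate m b ++ [a])
    (h : traces (par (pre a zero) q) = traces (par (pre a zero) (bPowA a b k) : Term A V)) :
    traces q = traces (bPowA a b k : Term A V) := by
  classical
  have key : ∀ m, List.replicate m b ++ [a] ∈ traces q → m = k := by
    intro m hm
    have h1 : [a] ++ (List.replicate m b ++ [a]) ∈ traces (par (pre a zero) q) :=
      mem_traces_par.2 ⟨[a], ⟨zero, steps_pre_zero.2 (.inr ⟨rfl, rfl⟩)⟩, _, hm, .append _ _⟩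
    rw [h, mem_traces_par] at h1
    obtain ⟨β, ⟨_, hβ⟩, γ, hγ, hs⟩ := h1
    have ea := hs.perm.count_eq a
    have eb := hs.perm.count_eq b
    rcases steps_pre_zero.1 hβ with ⟨rfl, -⟩ | ⟨rfl, -⟩ <;>
    rcases mem_traces_bPowA.1 hγ with ⟨n, hn, rfl⟩ | rfl <;>
    simp [List.count_replicate, hab, hab.symm] at ea eb
    exact eb
  have ea : maxCount a q = 1 := by
    have h1 : 1 + maxCount a q = 1 + maxCount a (bPowA a b k : Term A V) := by
      simpa [weight] using weight_congr (fun x => if x = a then 1 else 0) h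
    rw [maxCount_left_bPowA hab] at h1
    omega
  have eb : maxCount b q = k := by
    have h1 : maxCount b q = maxCount b (bPowA a b k : Term A V) := by
      simpa [weight, hab] using weight_congr (fun x => if x = b then 1 else 0) h
    rwa [maxCount_right_bPowA hab] at h1
  have hk : List.replicate k b ++ [a] ∈ traces q := by
    obtain ⟨α, hα, haα⟩ := exists_trace_mem (ea ▸ one_pos)
    obtain ⟨m, rfl | rfl⟩ := hq α hα
    · exact absurd (List.eq_of_mem_replicate haα) hab
    · rwa [← key m hα]
  ext α
  rw [mem_traces_bPowA]
  constructor
  · intro hα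
    obtain ⟨m, rfl | rfl⟩ := hq α hα
    · refine .inl ⟨m, ?_, rfl⟩
      have := sum_le_weight (fun x => if x = b then 1 else 0) hα
      simp only [List.map_replicate, if_true, List.sum_replicate, smul_eq_mul, mul_one] at this
      exact this.trans eb.le
    · rw [key m hα]
      exact .inr rfl
  · rintro (⟨n, hn, rfl⟩ | rfl)
    · refine mem_traces_of_append (β := List.replicate (k - n) b ++ [a]) ?_
      rwa [← List.append_assoc, List.replicate_append_replicate, Nat.add_sub_cancel' hn]
    · exact hk

/-- After a trace `bⁱa`, a term with the traces of `p_N` is done. -/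
theorem depth_eq_zero_of_steps_of_traces_eq {a b : A} (hab : a ≠ b) {N n : ℕ} {p r : Term A V}
    (hp : traces p = traces (pN a b N : Term A V))
    (h : Steps p (List.replicate n b ++ [a]) r) : depth r = 0 := by
  by_contra hr
  obtain ⟨c, r', hc⟩ := depth_pos_iff.1 (Nat.pos_of_ne_zero hr)
  refine not_mem_init_pN hab (hp ▸ ⟨r', h.trans (steps_singleton.2 hc)⟩ :
    (List.replicate n b ++ [a]) ++ [c] ∈ traces (pN a b N : Term A V)) (by simp)

/-- For a term with the traces of `p_N`, the trace sets reached by powers of `b` determine the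
possible futures. -/
theorem pfEquiv_pN {a b : A} (hab : a ≠ b) {N : ℕ} {q : Term A V}
    (hq : traces q = traces (pN a b N : Term A V))
    (H : ∀ n q', Steps q (List.replicate (n + 1) b) q' →
      ∃ k, k + n < N ∧ traces q' = traces (bPowA a b k : Term A V)) :
    PFEquiv q (pN a b N) := by
  refine .of_proper hq ?_ ?_
  · intro c α q' h
    rcases cons_mem_traces_pN.1 (hq ▸ ⟨q', h⟩ : c :: α ∈ traces (pN a b N : Term A V)) with
      ⟨n, hn, e⟩ | ⟨n, hn, e⟩
    · rw [e] at h ⊢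
      obtain ⟨k, hk, ek⟩ := H n q' h
      exact ⟨_, (steps_pN_replicate hab).2 ⟨k, hk, rfl⟩, ek.symm⟩
    · obtain ⟨r, hr⟩ : c :: α ∈ traces (pN a b N : Term A V) :=
        cons_mem_traces_pN.2 (.inr ⟨n, hn, e⟩)
      refine ⟨r, hr, ?_⟩
      rw [e] at h hr
      exact ((pfEquiv_zero_iff.2 (depth_eq_zero_of_steps_of_traces_eq hab rfl hr)).trans
        (pfEquiv_zero_iff.2 (depth_eq_zero_of_steps_of_traces_eq hab hq h)).symm).traces_eq
  · intro c α q' h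
    rcases cons_mem_traces_pN.1 ⟨q', h⟩ with ⟨n, hn, e⟩ | ⟨n, hn, e⟩
    · rw [e] at h ⊢
      obtain ⟨k, hk, rfl⟩ := (steps_pN_replicate hab).1 h
      obtain ⟨r, hr⟩ : List.replicate (n + 1) b ++ (List.replicate k b ++ [a]) ∈ traces q := by
        rw [hq, ← List.append_assoc, List.replicate_append_replicate,
          show n + 1 + k = (n + k) + 1 by omega, List.replicate_succ, List.cons_append]
        exact cons_mem_traces_pN.2 (.inr ⟨n + k, by omega, rfl⟩)
      obtain ⟨q'', h1, h2⟩ := steps_append.1 hr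
      obtain ⟨m, hm, em⟩ := H n q'' h1
      refine ⟨q'', h1, em.trans ?_⟩
      rcases mem_traces_bPowA.1 (em ▸ ⟨r, h2⟩ : List.replicate k b ++ [a] ∈
        traces (bPowA a b m : Term A V)) with ⟨l, hl, h⟩ | h
      · exact absurd (List.eq_of_mem_replicate (h ▸ by simp : a ∈ List.replicate l b)) hab
      · have := congrArg List.length h
        simp only [List.length_append, List.length_replicate, List.length_singleton] at this
        rw [show m = k by omega]
    · obtain ⟨r, hr⟩ : c :: α ∈ traces q := hq ▸ ⟨q', h⟩
      refine ⟨r, hr, ?_⟩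
      rw [e] at h hr
      exact ((pfEquiv_zero_iff.2 (depth_eq_zero_of_steps_of_traces_eq hab hq hr)).trans
        (pfEquiv_zero_iff.2 (depth_eq_zero_of_steps_of_traces_eq hab rfl h)).symm).traces_eq

/-- A nontrivial parallel composition whose possible futures after nonempty traces are among those
of `a ‖ p_N`, and whose left factor can perform `a`, decomposes as `a ‖ p_N` does: its factors are
equivalent to `a` and `p_N`. -/
theorem pfEquiv_factors_lhsN {a b : A} (hab : a ≠ b) {N : ℕ} (hN : 1 ≤ N) {p q p₀ : Term A V}
    (hq : 0 < depth q) (h : ProperPFLe (par p q) (lhsN a b N)) (hp₀ : Step p a p₀) :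
    PFEquiv p (pre a zero) ∧ PFEquiv q (pN a b N) := by
  classical
  have hstep : ∀ p', Step p a p' → depth p' = 0 ∧ traces q = traces (pN a b N : Term A V) := by
    intro p' hp'
    obtain ⟨s', hs', e⟩ := h.exists_step (.parLeft q hp')
    have hs : s' = par zero (pN a b N) := by
      rcases step_lhsN.1 hs' with ⟨-, h⟩ | ⟨h, -⟩
      · exact h
      · exact absurd h hab
    subst hs
    rw [traces_par_of_depth_eq_zero rfl] at e
    -- the action `a` ends every trace of `p_N`, so it cannot come from `p'`
    have h1 : maxCount a p' = 0 := by
      by_contra h1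
      have := depth_eq_zero_of_par (q := q) (fun α c hα => not_mem_init_pN hab (e ▸ hα))
        (Nat.pos_of_ne_zero h1)
      omega
    have h2 : maxCount a p' + maxCount a q = 1 :=
      (weight_congr _ e).symm.trans (maxCount_left_pN hab hN)
    have h3 : depth p' = 0 := depth_eq_zero_of_par (p := q) (a := a)
      (fun α c hα => not_mem_init_pN hab (e ▸ traces_par_comm q p' ▸ hα)) (by omega)
    exact ⟨h3, (e.trans (traces_par_of_depth_eq_zero h3 q)).symm⟩
  have hTq := (hstep p₀ hp₀).2
  have hb : maxCount b p = 0 := by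
    have h1 : maxCount b p + maxCount b q ≤ maxCount b (lhsN a b N : Term A V) :=
      weight_le_of_traces_subset _ h.traces_subset
    have h2 : maxCount b (lhsN a b N : Term A V) = 0 + maxCount b (pN a b N : Term A V) := by
      simp [lhsN, weight, hab]
    have h3 : maxCount b q = maxCount b (pN a b N : Term A V) := weight_congr _ hTq
    rw [maxCount_right_pN hab hN] at h2 h3
    omega
  have hp : PFEquiv p (pre a zero) := by
    refine .of_step (fun c p' hp' => ?_) (fun c r hr => ?_)
    · obtain ⟨s', hs', -⟩ := h.exists_step (.parLeft q hp')
      obtain rfl : c = a := by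
        rcases step_lhsN.1 hs' with ⟨h, -⟩ | ⟨rfl, -⟩
        · exact h
        · have := maxCount_pos_of_mem (a := c) ⟨p', steps_singleton.2 hp'⟩ (by simp)
          omega
      exact ⟨zero, .pre _ _, pfEquiv_zero_iff.2 (hstep p' hp').1⟩
    · cases hr
      exact ⟨p₀, hp₀, (pfEquiv_zero_iff.2 (hstep p₀ hp₀).1).symm⟩
  refine ⟨hp, pfEquiv_pN hab hTq fun n q' hq' => ?_⟩
  obtain ⟨s', hs', e⟩ := h b (List.replicate n b) (par p q')
    (steps_par.2 ⟨[], List.replicate (n + 1) b, p, q', .nil_left _, rfl, hq', rfl⟩)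
  obtain ⟨β, γ, p1, q1, hs, h1, h2, rfl⟩ := steps_par.1 hs'
  obtain ⟨rfl, rfl⟩ : β = [] ∧ p1 = pre a zero := by
    rcases steps_pre_zero.1 h1 with h1 | ⟨rfl, -⟩
    · exact h1
    · exact absurd (List.eq_of_mem_replicate (n := n + 1) (hs.perm.mem_iff.2 (by simp) :
        a ∈ List.replicate (n + 1) b)) hab
  obtain ⟨k, hk, rfl⟩ := (steps_pN_replicate hab).1 (hs.eq_of_nil_left ▸ h2)
  refine ⟨k, hk, traces_eq_of_par_pre hab (fun α hα => ?_)
    ((traces_par_congr hp.traces_eq rfl).symm.trans e.symm)⟩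
  obtain ⟨r, hr⟩ := hα
  obtain ⟨r', t, ht1, ht2⟩ : List.replicate (n + 1) b ++ α ∈ traces (pN a b N : Term A V) :=
    hTq ▸ ⟨r, hq'.trans hr⟩
  obtain ⟨-, m, hm, rfl⟩ := step_pN.1 ht1
  obtain ⟨t', h3, h4⟩ := steps_append.1 ht2
  obtain ⟨l, -, rfl⟩ := (steps_bPowA_replicate hab).1 h3
  rcases mem_traces_bPowA.1 ⟨r', h4⟩ with ⟨n, -, hn⟩ | hn
  · exact ⟨n, .inl hn⟩
  · exact ⟨l, .inr hn⟩

/-! ### Summands modulo `0` summands and factors -/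

/-- The summands of `t` that remain once the summands and factors that become equivalent to `0`
under `σ` are removed. The factors of a remaining parallel composition are not simplified. For a
closed term `σ` is immaterial, and `σ = var` is used. -/
def properSummands (σ : V → Term A V) : Term A V → Set (Term A V)
  | zero => ∅
  | var x => {r | r = var x ∧ 0 < depth (σ x)}
  | pre a t => {pre a t}
  | add t u => properSummands σ t ∪ properSummands σ u
  | par t u => {r | (depth (subst σ u) = 0 ∧ r ∈ properSummands σ t) ∨
      (depth (subst σ t) = 0 ∧ r ∈ properSummands σ u) ∨
      (0 < depth (subst σ t) ∧ 0 < depth (subst σ u) ∧ r = par t u)}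

theorem cases_of_mem_properSummands {σ : V → Term A V} {t r : Term A V}
    (h : r ∈ properSummands σ t) :
    (∃ x, r = var x ∧ 0 < depth (σ x)) ∨ (∃ c r', r = pre c r') ∨
      ∃ r₁ r₂, r = par r₁ r₂ ∧ 0 < depth (subst σ r₁) ∧ 0 < depth (subst σ r₂) := by
  induction t with
  | zero => exact h.elim
  | var x => exact .inl ⟨x, h⟩
  | pre a t => exact .inr (.inl ⟨a, t, h⟩)
  | add t u iht ihu => exact h.elim iht ihu
  | par t u iht ihu =>
    rcases h with ⟨-, h⟩ | ⟨-, h⟩ | ⟨h1, h2, h⟩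
    · exact iht h
    · exact ihu h
    · exact .inr (.inr ⟨t, u, h, h1, h2⟩)

theorem depth_pos_of_mem_properSummands {σ : V → Term A V} {t r : Term A V}
    (h : r ∈ properSummands σ t) : 0 < depth (subst σ r) := by
  rcases cases_of_mem_properSummands h with ⟨x, rfl, hx⟩ | ⟨c, r', rfl⟩ | ⟨r₁, r₂, rfl, h₁, -⟩
  · exact hx
  · simp [subst, weight]
  · simp only [depth, subst, weight] at h₁ ⊢; omega

theorem size_le_of_mem_properSummands {σ : V → Term A V} {t r : Term A V}
    (h : r ∈ properSummands σ t) : r.size ≤ t.size := by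
  induction t with
  | zero => exact h.elim
  | var x => exact (congrArg size h.1).le
  | pre a t => exact (congrArg size h).le
  | add t u iht ihu =>
    simp only [size]
    rcases h with h | h
    · have := iht h; omega
    · have := ihu h; omega
  | par t u iht ihu =>
    simp only [size]
    rcases h with ⟨-, h⟩ | ⟨-, h⟩ | ⟨-, -, h⟩
    · have := iht h; omega
    · have := ihu h; omega
    · exact (congrArg size h).le

theorem properPFLe_of_mem_properSummands {σ : V → Term A V} {t r : Term A V}
    (h : r ∈ properSummands σ t) : ProperPFLe (subst σ r) (subst σ t) := by
  induction t with
  | zero => exact h.elim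
  | var x => rw [h.1]; exact .refl _
  | pre a t => rw [show r = _ from h]; exact .refl _
  | add t u iht ihu =>
    rcases h with h | h
    · exact (iht h).trans fun c α p' hp => ⟨p', hp.addLeft _, rfl⟩
    · exact (ihu h).trans fun c α p' hp => ⟨p', hp.addRight _, rfl⟩
  | par t u iht ihu =>
    rcases h with ⟨h0, h⟩ | ⟨h0, h⟩ | ⟨-, -, h⟩
    · exact (iht h).trans (pfEquiv_par_of_depth_eq_zero_right h0 _).symm.properPFLe
    · exact (ihu h).trans (pfEquiv_par_of_depth_eq_zero h0 _).symm.properPFLe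
    · rw [h]; exact .refl _

theorem exists_properSummand_step {σ : V → Term A V} {t v : Term A V} {c : A}
    (h : Step (subst σ t) c v) :
    ∃ r ∈ properSummands σ t, ∃ v', Step (subst σ r) c v' ∧ traces v' = traces v := by
  induction t generalizing v with
  | zero => cases h
  | var x => exact ⟨var x, ⟨rfl, depth_pos_iff.2 ⟨c, v, h⟩⟩, v, h, rfl⟩
  | pre a t => exact ⟨_, rfl, v, h, rfl⟩
  | add t u iht ihu =>
    cases h with
    | addLeft _ h => obtain ⟨r, hr, h⟩ := iht h; exact ⟨r, .inl hr, h⟩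
    | addRight _ h => obtain ⟨r, hr, h⟩ := ihu h; exact ⟨r, .inr hr, h⟩
  | par t u iht ihu =>
    rcases Nat.eq_zero_or_pos (depth (subst σ u)) with hu | hu
    · obtain ⟨w, hw, e⟩ :=
        (pfEquiv_par_of_depth_eq_zero_right hu (subst σ t)).properPFLe.exists_step h
      obtain ⟨r, hr, v', h1, h2⟩ := iht hw
      exact ⟨r, .inl ⟨hu, hr⟩, v', h1, h2.trans e⟩
    · rcases Nat.eq_zero_or_pos (depth (subst σ t)) with ht | ht
      · obtain ⟨w, hw, e⟩ :=
          (pfEquiv_par_of_depth_eq_zero ht (subst σ u)).properPFLe.exists_step h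
        obtain ⟨r, hr, v', h1, h2⟩ := ihu hw
        exact ⟨r, .inr (.inl ⟨ht, hr⟩), v', h1, h2.trans e⟩
      · exact ⟨_, .inr (.inr ⟨ht, hu, rfl⟩), v, h, rfl⟩

theorem depth_subst_eq_zero_congr {σ τ : V → Term A V}
    (h : ∀ x, depth (σ x) = 0 ↔ depth (τ x) = 0) (t : Term A V) :
    depth (subst σ t) = 0 ↔ depth (subst τ t) = 0 := by
  induction t with
  | zero => exact Iff.rfl
  | var x => exact h x
  | pre a t ih => simp [subst, weight]
  | add t u iht ihu => simp only [depth, subst, weight] at *; omega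
  | par t u iht ihu => simp only [depth, subst, weight] at *; omega

theorem properSummands_congr {σ τ : V → Term A V}
    (h : ∀ x, depth (σ x) = 0 ↔ depth (τ x) = 0) (t : Term A V) :
    properSummands σ t = properSummands τ t := by
  induction t with
  | zero => rfl
  | var x => simp only [properSummands, Nat.pos_iff_ne_zero, ne_eq, h x]
  | pre a t => rfl
  | add t u iht ihu => simp only [properSummands, iht, ihu]
  | par t u iht ihu =>
    simp only [properSummands, iht, ihu, Nat.pos_iff_ne_zero, ne_eq,
      depth_subst_eq_zero_congr h t, depth_subst_eq_zero_congr h u]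

/-- `p` has a proper summand that is possible futures equivalent to `s`. Unlike `HasSummandEquiv`,
this property is insensitive to `0` summands and factors of `p`. -/
def HasProperSummand (p s : Term A V) : Prop := ∃ r ∈ properSummands var p, PFEquiv r s

theorem HasProperSummand.depth_pos {p s : Term A V} (h : HasProperSummand p s) : 0 < depth p := by
  obtain ⟨r, hr, -⟩ := h
  have h1 := depth_pos_of_mem_properSummands hr
  have h2 := weight_le_of_traces_subset (fun _ => 1)
    (properPFLe_of_mem_properSummands hr).traces_subset
  simp only [subst_var] at h1 h2
  exact h1.trans_le h2

theorem HasProperSummand.par_iff {p q s : Term A V} (hp : 0 < depth p) (hq : 0 < depth q) :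
    HasProperSummand (par p q) s ↔ PFEquiv (par p q) s := by
  have h : properSummands var (par p q) = {par p q} := by
    ext r
    simp only [properSummands, subst_var, Set.mem_ofPred_eq, hp.ne', hq.ne', false_and, hp, hq,
      true_and, false_or, Set.mem_singleton_iff]
  simp [HasProperSummand, h]

theorem HasProperSummand.pre_iff {p s : Term A V} {c : A} :
    HasProperSummand (pre c p) s ↔ PFEquiv (pre c p) s := by
  simp [HasProperSummand, properSummands]

theorem HasProperSummand.add_iff {p q s : Term A V} :
    HasProperSummand (add p q) s ↔ HasProperSummand p s ∨ HasProperSummand q s := by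
  simp [HasProperSummand, properSummands, or_and_right, exists_or]

theorem HasProperSummand.par_iff_left {p q s : Term A V} (hq : depth q = 0) :
    HasProperSummand (par p q) s ↔ HasProperSummand p s := by
  refine ⟨fun ⟨r, hr, e⟩ => ?_, fun ⟨r, hr, e⟩ => ⟨r, .inl ⟨by rwa [subst_var], hr⟩, e⟩⟩
  rcases hr with ⟨-, h⟩ | ⟨-, h⟩ | ⟨-, h, -⟩
  · exact ⟨r, h, e⟩
  · have := HasProperSummand.depth_pos ⟨r, h, e⟩
    omega
  · rw [subst_var] at h
    omega

theorem HasProperSummand.par_iff_right {p q s : Term A V} (hp : depth p = 0) :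
    HasProperSummand (par p q) s ↔ HasProperSummand q s := by
  refine ⟨fun ⟨r, hr, e⟩ => ?_,
    fun ⟨r, hr, e⟩ => ⟨r, .inr (.inl ⟨by rwa [subst_var], hr⟩), e⟩⟩
  rcases hr with ⟨-, h⟩ | ⟨-, h⟩ | ⟨h, -, -⟩
  · have := HasProperSummand.depth_pos ⟨r, h, e⟩
    omega
  · exact ⟨r, h, e⟩
  · rw [subst_var] at h
    omega

theorem hasProperSummand_subst_iff {σ : V → Term A V} {t s : Term A V} :
    HasProperSummand (subst σ t) s ↔
      ∃ r ∈ properSummands σ t, HasProperSummand (subst σ r) s := by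
  induction t with
  | zero => simp [HasProperSummand, properSummands, subst]
  | var x =>
    exact ⟨fun h => ⟨var x, ⟨rfl, h.depth_pos⟩, h⟩, fun ⟨r, ⟨hr, _⟩, h⟩ => hr ▸ h⟩
  | pre a t => simp [properSummands]
  | add t u iht ihu =>
    simp only [subst, HasProperSummand.add_iff, iht, ihu, properSummands, Set.mem_union,
      or_and_right, exists_or]
  | par t u iht ihu =>
    rw [subst]
    rcases Nat.eq_zero_or_pos (depth (subst σ u)) with hu | hu
    · rw [HasProperSummand.par_iff_left hu, iht]
      refine ⟨fun ⟨r, hr, h⟩ => ⟨r, .inl ⟨hu, hr⟩, h⟩, ?_⟩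
      rintro ⟨r, ⟨-, hr⟩ | ⟨-, hr⟩ | ⟨-, h, -⟩, h'⟩
      · exact ⟨r, hr, h'⟩
      · have := (ihu.2 ⟨r, hr, h'⟩).depth_pos
        omega
      · omega
    · rcases Nat.eq_zero_or_pos (depth (subst σ t)) with ht | ht
      · rw [HasProperSummand.par_iff_right ht, ihu]
        refine ⟨fun ⟨r, hr, h⟩ => ⟨r, .inr (.inl ⟨ht, hr⟩), h⟩, ?_⟩
        rintro ⟨r, ⟨h, -⟩ | ⟨-, hr⟩ | ⟨h, -, -⟩, h'⟩
        · omega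
        · exact ⟨r, hr, h'⟩
        · omega
      · refine ⟨fun h => ⟨_, .inr (.inr ⟨ht, hu, rfl⟩), h⟩, ?_⟩
        rintro ⟨r, ⟨h, -⟩ | ⟨h, -⟩ | ⟨-, -, rfl⟩, h'⟩
        · omega
        · omega
        · exact h'

theorem depth_pos_of_not_valid_zero {p : Term A V} (hp : p.Closed)
    (h : ¬ Valid PFEquiv p zero) : 0 < depth p := by
  by_contra h0
  refine h fun σ _ => ?_
  rw [hp.subst_eq]
  exact pfEquiv_zero_iff.2 (by omega)

theorem hasSummandEquiv_iff {p s : Term A V} (hp : p.Closed) (h0 : p.NoZero) :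
    HasSummandEquiv p s ↔ HasProperSummand p s := by
  induction p with
  | zero => simp [HasSummandEquiv, HasProperSummand, summands, properSummands]
  | var x => exact hp.elim
  | pre a t => simp [HasSummandEquiv, HasProperSummand, summands, properSummands]
  | add t u iht ihu =>
    rw [HasProperSummand.add_iff, ← iht hp.1 h0.2.2.1, ← ihu hp.2 h0.2.2.2]
    simp [HasSummandEquiv, summands, or_and_right, exists_or]
  | par t u =>
    rw [HasProperSummand.par_iff (depth_pos_of_not_valid_zero hp.1 h0.1)
      (depth_pos_of_not_valid_zero hp.2 h0.2.1)]
    simp [HasSummandEquiv, summands]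

/-! ### Small terms equivalent to `p_N` have variable summands -/

/-- If the transitions of `p ‖ q` are `b`-transitions to terms with the traces of some `bᵏa`, then
one of the factors is equivalent to `0`. -/
theorem not_depth_pos_of_par {a b : A} (hab : a ≠ b) {p q : Term A V}
    (h : ∀ c v, Step (par p q) c v →
      c = b ∧ ∃ k, traces v = traces (bPowA a b k : Term A V)) :
    ¬ (0 < depth p ∧ 0 < depth q) := by
  rintro ⟨hp, hq⟩
  have key : ∀ p q : Term A V, 0 < depth q →
      (∀ c v, Step (par p q) c v →
        c = b ∧ ∃ k, traces v = traces (bPowA a b k : Term A V)) → maxCount a p = 0 := by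
    intro p q hq h
    by_contra h0
    obtain ⟨α, ⟨p', hα⟩, ha⟩ := exists_trace_mem (Nat.pos_of_ne_zero h0)
    rcases α with _ | ⟨c, α⟩
    · simp at ha
    obtain ⟨r, h1, h2⟩ := hα
    obtain ⟨rfl, k, hk⟩ := h c _ (.parLeft q h1)
    have ha' : a ∈ α := (List.mem_cons.1 ha).resolve_left hab
    have := depth_eq_zero_of_par (q := q) (fun α c hα => not_mem_init_bPowA hab (hk ▸ hα))
      (maxCount_pos_of_mem ⟨p', h2⟩ ha')
    omega
  have hp0 := key p q hq h
  have hq0 := key q p hp fun c v hv => by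
    obtain ⟨w, hw, e⟩ := (pfEquiv_par_comm q p).properPFLe.exists_step hv
    exact e ▸ h c w hw
  obtain ⟨c, p', hp'⟩ := depth_pos_iff.1 hp
  obtain ⟨-, k, hk⟩ := h c _ (.parLeft q hp')
  have h1 : maxCount a p' + maxCount a q = 1 :=
    (weight_congr _ hk).trans (maxCount_left_bPowA hab k)
  have h2 : _ + maxCount a p' ≤ maxCount a p := hp'.weight_le
  omega

/-- If no variable is a proper summand of `t`, then each summand of `t` accounts for at most one of
the traces `bⁱ⁺¹a` of `σ(t)`, since only a prefix can be such a summand. Hence the size of `t` bounds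
the number of these traces. -/
theorem card_le_size_of_no_var_summand {a b : A} (hab : a ≠ b) {σ : V → Term A V} {t : Term A V}
    (ht : ∀ x, var x ∉ properSummands σ t)
    (h : ∀ c v, Step (subst σ t) c v →
      c = b ∧ ∃ k, traces v = traces (bPowA a b k : Term A V))
    (S : Finset ℕ) (hS : ∀ i ∈ S, List.replicate (i + 1) b ++ [a] ∈ traces (subst σ t)) :
    S.card ≤ t.size + 1 := by
  classical
  have hzero : ∀ (t : Term A V) (S : Finset ℕ), depth t = 0 →
      (∀ i ∈ S, List.replicate (i + 1) b ++ [a] ∈ traces t) → S.card = 0 := by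
    intro t S h0 hS
    refine Finset.card_eq_zero.2 (Finset.eq_empty_of_forall_notMem fun i hi => ?_)
    have := eq_nil_of_depth_eq_zero h0 (hS i hi)
    simp at this
  induction t generalizing S with
  | zero => exact (hzero _ S rfl hS).le.trans (Nat.zero_le _)
  | var x =>
    refine (hzero _ S ?_ hS).le.trans (Nat.zero_le _)
    by_contra h0
    exact ht x ⟨rfl, Nat.pos_of_ne_zero h0⟩
  | pre c t =>
    refine le_trans (Finset.card_le_one.2 fun i hi j hj => ?_) (Nat.le_add_left _ _)
    obtain ⟨-, k, hk⟩ := h c _ (.pre _ _)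
    have key : ∀ i ∈ S, i = k := by
      intro i hi
      obtain ⟨r, hr⟩ := hS i hi
      have h1 : List.replicate i b ++ [a] ∈ traces (subst σ t) := ⟨r, (steps_pre.1 hr).2⟩
      rcases mem_traces_bPowA.1 (hk ▸ h1) with ⟨n, -, h2⟩ | h2
      · exact absurd (List.eq_of_mem_replicate (h2 ▸ by simp : a ∈ List.replicate n b)) hab
      · simpa using congrArg List.length h2
    rw [key i hi, key j hj]
  | add t u iht ihu =>
    have h1 := iht (fun x hx => ht x (.inl hx)) (fun c v hv => h c v (.addLeft _ hv))
      (S.filter fun i => List.replicate (i + 1) b ++ [a] ∈ traces (subst σ t))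
      (fun i hi => (Finset.mem_filter.1 hi).2)
    have h2 := ihu (fun x hx => ht x (.inr hx)) (fun c v hv => h c v (.addRight _ hv))
      (S.filter fun i => ¬ List.replicate (i + 1) b ++ [a] ∈ traces (subst σ t))
      (fun i hi => by
        obtain ⟨hi, hi'⟩ := Finset.mem_filter.1 hi
        obtain ⟨r, hr⟩ := hS i hi
        exact (steps_add.1 hr).elim (fun hr => absurd ⟨r, hr⟩ hi') fun hr => ⟨r, hr⟩)
    rw [← Finset.card_filter_add_card_filter_not (s := S)
      (fun i => List.replicate (i + 1) b ++ [a] ∈ traces (subst σ t))]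
    simp only [size]
    omega
  | par t u iht ihu =>
    have h0 := not_depth_pos_of_par hab h
    simp only [size]
    rcases Nat.eq_zero_or_pos (depth (subst σ u)) with hu | hu
    · have e := pfEquiv_par_of_depth_eq_zero_right hu (subst σ t)
      have := iht (fun x hx => ht x (.inl ⟨hu, hx⟩)) (fun c v hv => by
        obtain ⟨w, hw, e'⟩ := e.symm.properPFLe.exists_step hv
        exact e' ▸ h c w hw) S (fun i hi => e.traces_eq ▸ hS i hi)
      omega
    · have hz : depth (subst σ t) = 0 := by omega
      have e := pfEquiv_par_of_depth_eq_zero hz (subst σ u)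
      have := ihu (fun x hx => ht x (.inr (.inl ⟨hz, hx⟩))) (fun c v hv => by
        obtain ⟨w, hw, e'⟩ := e.symm.properPFLe.exists_step hv
        exact e' ▸ h c w hw) S (fun i hi => e.traces_eq ▸ hS i hi)
      omega

/-! ### Detecting a variable by a long sequence of actions -/

/-- The term `bⁿ`, that is, `b.b.⋯.b.0` with `n` occurrences of `b`. -/
def prePow (b : A) : ℕ → Term A V
  | 0 => zero
  | n + 1 => pre b (prePow b n)

theorem closed_prePow (b : A) (n : ℕ) : (prePow b n : Term A V).Closed := by
  induction n with
  | zero => trivial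
  | succ n ih => exact ih

theorem weight_prePow (f : A → ℕ) (b : A) (n : ℕ) :
    weight f (prePow b n : Term A V) = n * f b := by
  induction n with
  | zero => simp [prePow, weight]
  | succ n ih => rw [prePow, weight, ih]; ring

theorem depth_prePow (b : A) (n : ℕ) : depth (prePow b n : Term A V) = n := by
  rw [depth, weight_prePow, mul_one]

theorem maxCount_prePow (b : A) (n : ℕ) : maxCount b (prePow b n : Term A V) = n := by
  rw [maxCount, weight_prePow, if_pos rfl, mul_one]

open Classical in
/-- The substitution `σ` with the term `bᴹ⁺¹` for the variable `x`. -/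
noncomputable def probe (σ : V → Term A V) (x : V) (b : A) (M : ℕ) : V → Term A V :=
  Function.update σ x (prePow b (M + 1))

theorem probe_self (σ : V → Term A V) (x : V) (b : A) (M : ℕ) :
    probe σ x b M x = prePow b (M + 1) := by
  classical exact Function.update_self _ _ _

theorem probe_of_ne {x y : V} (h : y ≠ x) (σ : V → Term A V) (b : A) (M : ℕ) :
    probe σ x b M y = σ y := by
  classical exact Function.update_of_ne h _ _

theorem closedSubst_probe {σ : V → Term A V} (hσ : ClosedSubst σ) (x : V) (b : A) (M : ℕ) :
    ClosedSubst (probe σ x b M) := by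
  intro y
  by_cases h : y = x
  · rw [h, probe_self]; exact closed_prePow b _
  · rw [probe_of_ne h]; exact hσ y

theorem properSummands_probe {σ : V → Term A V} {x : V} (hx : 0 < depth (σ x)) (b : A) (M : ℕ)
    (t : Term A V) : properSummands (probe σ x b M) t = properSummands σ t := by
  refine properSummands_congr (fun y => ?_) t
  by_cases h : y = x
  · rw [h, probe_self, depth_prePow]; omega
  · rw [probe_of_ne h]

theorem Occurs.lt_maxCount_probe {x : V} {t : Term A V} (h : Occurs x t) (σ : V → Term A V)
    (b : A) (M : ℕ) : M < maxCount b (subst (probe σ x b M) t) := by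
  have := h.weight_le (fun y => by classical exact if y = b then 1 else 0) (probe σ x b M)
  rw [probe_self] at this
  exact (maxCount_prePow (V := V) b (M + 1)).ge.trans this

theorem subst_probe {x : V} {t : Term A V} (h : ¬ Occurs x t) (σ : V → Term A V)
    (b : A) (M : ℕ) : subst (probe σ x b M) t = subst σ t :=
  subst_update_of_not_occurs h _ _

/-- When `bᴹ⁺¹` is substituted for `x` and a transition is taken, the result either contains an
unused copy of `bᴹ⁺¹`, or it contains no copy at all, or a copy has made the transition; in the last
case the rest of the term is either equivalent to `0` or makes the result longer than `bᴹ`. -/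
theorem step_probe_cases {σ : V → Term A V} {x : V} {b c : A} {M : ℕ} {t v : Term A V}
    (h : Step (subst (probe σ x b M) t) c v) :
    M < maxCount b v ∨ depth v ≤ depth (subst σ t) ∨
      traces v = traces (prePow b M : Term A V) ∨ M < depth v := by
  induction t generalizing v with
  | zero => cases h
  | var y =>
    by_cases hy : y = x
    · rw [subst, hy, probe_self] at h
      cases h
      exact .inr (.inr (.inl rfl))
    · rw [subst_probe (t := var y) hy] at h
      have := h.weight_le (f := fun _ => 1)
      exact .inr (.inl (by simp only [depth]; omega))
  | pre d t =>
    by_cases ht : Occurs x t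
    · cases h
      exact .inl (ht.lt_maxCount_probe σ b M)
    · rw [subst_probe (t := pre d t) ht] at h
      have := h.weight_le (f := fun _ => 1)
      exact .inr (.inl (by simp only [depth]; omega))
  | add t u iht ihu =>
    have e : depth (subst σ (add t u)) = max (depth (subst σ t)) (depth (subst σ u)) := rfl
    rw [e]
    cases h with
    | addLeft _ h => exact (iht h).imp id (.imp (le_max_of_le_left ·) id)
    | addRight _ h => exact (ihu h).imp id (.imp (le_max_of_le_right ·) id)
  | par t u iht ihu =>
    -- by symmetry of the conclusion, one lemma treats a transition of either factor
    have key : ∀ t u w v : Term A V, traces v = traces (par w (subst (probe σ x b M) u)) →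
        (M < maxCount b w ∨ depth w ≤ depth (subst σ t) ∨
          traces w = traces (prePow b M : Term A V) ∨ M < depth w) →
        M < maxCount b v ∨ depth v ≤ depth (subst σ t) + depth (subst σ u) ∨
          traces v = traces (prePow b M : Term A V) ∨ M < depth v := by
      intro t u w v e h
      have e1 : depth v = depth w + depth (subst (probe σ x b M) u) := weight_congr _ e
      have e2 : maxCount b v = maxCount b w + maxCount b (subst (probe σ x b M) u) :=
        weight_congr _ e
      by_cases hu : Occurs x u
      · have := hu.lt_maxCount_probe σ b M
        exact .inl (by omega)
      · rw [subst_probe hu] at e e1 e2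
        rcases h with h | h | h | h
        · exact .inl (by omega)
        · exact .inr (.inl (by omega))
        · rcases Nat.eq_zero_or_pos (depth (subst σ u)) with h0 | h0
          · exact .inr (.inr (.inl
              ((e.trans (pfEquiv_par_of_depth_eq_zero_right h0 w).traces_eq).trans h)))
          · have : depth w = M := (weight_congr _ h).trans (depth_prePow (V := V) b M)
            exact .inr (.inr (.inr (by omega)))
        · exact .inr (.inr (.inr (by omega)))
    cases h with
    | parLeft _ h => exact key t u _ _ rfl (iht h)
    | parRight _ h =>
      have := key u t _ _ (traces_par_comm _ _) (ihu h)
      rwa [add_comm] at this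

/-- The possible sources of a transition to a term with `M` occurrences of `b` and of depth `M` or
`M + 1`, where `M` is large. -/
theorem source_of_step_probe {σ : V → Term A V} {x : V} {b c : A} {M : ℕ} {r v : Term A V}
    (hx : 0 < depth (σ x)) {u : Term A V} (hr : r ∈ properSummands σ u)
    (h : Step (subst (probe σ x b M) r) c v) (hb : maxCount b v ≤ M)
    (hM : depth (subst σ u) < M) (h1 : M ≤ depth v) (h2 : depth v ≤ M + 1) :
    (r = var x ∧ depth v = M) ∨ ∃ r₁ r₂, (r = par r₁ r₂ ∨ r = par r₂ r₁) ∧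
      0 < depth (subst σ r₁) ∧ 0 < depth (subst σ r₂) ∧
      traces v = traces (par (prePow b M) (subst σ r₂)) := by
  have hle : depth (subst σ r) ≤ depth (subst σ u) :=
    weight_le_of_traces_subset _ (properPFLe_of_mem_properSummands hr).traces_subset
  -- a parallel composition whose left factor makes the transition
  have key : ∀ r₁ r₂ w v : Term A V, 0 < depth (subst σ r₂) →
      depth (subst σ r₁) + depth (subst σ r₂) < M → maxCount b v ≤ M → M ≤ depth v →
      depth v ≤ M + 1 → Step (subst (probe σ x b M) r₁) c w →
      traces v = traces (par w (subst (probe σ x b M) r₂)) →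
      traces v = traces (par (prePow b M) (subst σ r₂)) := by
    intro r₁ r₂ w v h0 hM hb h1 h2 h e
    have e1 : depth v = depth w + depth (subst (probe σ x b M) r₂) := weight_congr _ e
    have e2 : maxCount b v = maxCount b w + maxCount b (subst (probe σ x b M) r₂) :=
      weight_congr _ e
    have hr₂ : ¬ Occurs x r₂ := by
      intro hr₂
      have := hr₂.lt_maxCount_probe σ b M
      omega
    rw [subst_probe hr₂] at e e1 e2
    rcases step_probe_cases h with h | h | h | h
    · omega
    · omega
    · exact e.trans (traces_par_congr h rfl)
    · omega
  rcases cases_of_mem_properSummands hr with ⟨y, rfl, -⟩ | ⟨d, r', rfl⟩ | ⟨r₁, r₂, rfl, h3, h4⟩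
  · by_cases hy : y = x
    · subst hy
      rw [subst, probe_self] at h
      cases h
      exact .inl ⟨rfl, depth_prePow b M⟩
    · rw [subst_probe (t := var y) hy] at h
      have : 1 + depth v ≤ depth (subst σ (var y)) := h.weight_le (f := fun _ => 1)
      omega
  · by_cases hr' : Occurs x r'
    · cases h
      have := hr'.lt_maxCount_probe σ b M
      omega
    · rw [subst_probe (t := pre d r') hr'] at h
      have : 1 + depth v ≤ depth (subst σ (pre d r')) := h.weight_le (f := fun _ => 1)
      omega
  · have hd : depth (subst σ (par r₁ r₂)) = depth (subst σ r₁) + depth (subst σ r₂) := rfl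
    refine .inr ?_
    cases h with
    | parLeft _ h =>
      exact ⟨r₁, r₂, .inl rfl, h3, h4, key r₁ r₂ _ _ h4 (by omega) hb h1 h2 h rfl⟩
    | parRight _ h =>
      exact ⟨r₂, r₁, .inr rfl, h4, h3,
        key r₂ r₁ _ _ h3 (by omega) hb h1 h2 h (traces_par_comm _ _)⟩

/-- A variable that is a summand of one side of a sound equation is a summand of the other side: the
substitution of `bᴹ⁺¹` for it gives a transition to a term equivalent to `bᴹ`, and no other summand
can match this transition. -/
theorem var_mem_properSummands_of_valid [Nonempty A] {t u : Term A V} (h : Valid PFEquiv t u)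
    {σ : V → Term A V} (hσ : ClosedSubst σ) {x : V} (hx : var x ∈ properSummands σ t) :
    var x ∈ properSummands σ u := by
  obtain ⟨b⟩ := ‹Nonempty A›
  have hx0 : 0 < depth (σ x) := depth_pos_of_mem_properSummands hx
  set M := depth (subst σ u) + 1
  have hs : Step (subst (probe σ x b M) (var x)) b (prePow b M) := by
    rw [subst, probe_self]; exact .pre _ _
  obtain ⟨v, hv, e⟩ := (properPFLe_of_mem_properSummands
    (properSummands_probe hx0 b M t ▸ hx)).exists_step hs
  obtain ⟨w, hw, e'⟩ := (h _ (closedSubst_probe hσ x b M)).properPFLe.exists_step hv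
  obtain ⟨r, hr, w', hw', e''⟩ := exists_properSummand_step hw
  rw [properSummands_probe hx0] at hr
  have ew := e''.trans (e'.trans e)
  have hd : depth w' = M := (weight_congr _ ew).trans (depth_prePow (V := V) b M)
  have hc : maxCount b w' = M := (weight_congr _ ew).trans (maxCount_prePow (V := V) b M)
  rcases source_of_step_probe hx0 hr hw' hc.le (Nat.lt_succ_self _) hd.ge (by omega) with
    ⟨rfl, -⟩ | ⟨r₁, r₂, -, -, h2, h3⟩
  · exact hr
  · have : depth w' = depth (prePow b M : Term A V) + depth (subst σ r₂) := weight_congr _ h3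
    rw [depth_prePow] at this
    omega

theorem properPFLe_of_mem_or_mem {σ : V → Term A V} {t t₁ t₂ : Term A V}
    (h : par t₁ t₂ ∈ properSummands σ t ∨ par t₂ t₁ ∈ properSummands σ t) :
    ProperPFLe (par (subst σ t₁) (subst σ t₂)) (subst σ t) := by
  rcases h with h | h
  · exact properPFLe_of_mem_properSummands h
  · exact (pfEquiv_par_comm _ _).properPFLe.trans (properPFLe_of_mem_properSummands h)

/-- If one side of a sound equation has a summand of the form `t₁ ‖ (x + t₂)` with `t₁` equivalent
to `a`, then the other side has a summand that is a parallel composition one of whose factors can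
perform `a`. -/
theorem exists_par_summand_of_valid {a b : A} (hab : a ≠ b) {t u : Term A V}
    (h : Valid PFEquiv t u) {σ : V → Term A V} (hσ : ClosedSubst σ) {x : V} {t₁ t₂ : Term A V}
    (ht : par t₁ t₂ ∈ properSummands σ t ∨ par t₂ t₁ ∈ properSummands σ t)
    (ht₁ : PFEquiv (subst σ t₁) (pre a zero)) (hx₁ : ¬ Occurs x t₁)
    (hx₂ : var x ∈ properSummands σ t₂) :
    ∃ u₁ u₂, (par u₁ u₂ ∈ properSummands σ u ∨ par u₂ u₁ ∈ properSummands σ u) ∧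
      0 < depth (subst σ u₁) ∧ 0 < depth (subst σ u₂) ∧ ∃ v, Step (subst σ u₂) a v := by
  have hx0 : 0 < depth (σ x) := depth_pos_of_mem_properSummands hx₂
  set M := depth (subst σ u) + 1
  have hs : Step (subst (probe σ x b M) (var x)) b (prePow b M) := by
    rw [subst, probe_self]; exact .pre _ _
  obtain ⟨v₂, hv₂, e₂⟩ := (properPFLe_of_mem_properSummands
    (properSummands_probe hx0 b M t₂ ▸ hx₂)).exists_step hs
  obtain ⟨v, hv, e⟩ := (properPFLe_of_mem_or_mem
    (properSummands_probe hx0 b M t ▸ ht)).exists_step (.parRight _ hv₂)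
  obtain ⟨w, hw, e'⟩ := (h _ (closedSubst_probe hσ x b M)).properPFLe.exists_step hv
  obtain ⟨r, hr, w', hw', e''⟩ := exists_properSummand_step hw
  rw [properSummands_probe hx0] at hr
  rw [subst_probe hx₁] at e
  -- the transition leads to a term with the traces of `a ‖ bᴹ`
  have ew : traces w' = traces (par (pre a zero) (prePow b M) : Term A V) :=
    (e''.trans (e'.trans e)).trans (traces_par_congr ht₁.traces_eq e₂)
  have hd : depth w' = 1 + M := by
    rw [← depth_prePow (V := V) b M]; exact weight_congr _ ew
  have hb : maxCount b w' = M := by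
    have := weight_congr (fun y => by classical exact if y = b then 1 else 0) ew
    simp only [weight, if_neg hab, zero_add] at this
    exact this.trans (maxCount_prePow b M)
  have ha : 1 ≤ maxCount a w' := by
    have := weight_congr (fun y => by classical exact if y = a then 1 else 0) ew
    simp only [weight, if_true] at this
    exact (show 1 ≤ 1 + 0 + _ by omega).trans this.ge
  rcases source_of_step_probe hx0 hr hw' hb.le (Nat.lt_succ_self _) (by omega) (by omega) with
    ⟨-, h0⟩ | ⟨r₁, r₂, hr', h1, h2, h3⟩
  · omega
  · refine ⟨r₁, r₂, hr'.elim (fun e => .inl (e ▸ hr)) (fun e => .inr (e ▸ hr)), h1, h2, ?_⟩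
    have e1 : depth w' = depth (prePow b M : Term A V) + depth (subst σ r₂) := weight_congr _ h3
    have e2 : maxCount a w' = maxCount a (prePow b M : Term A V) + maxCount a (subst σ r₂) :=
      weight_congr _ h3
    have e3 : maxCount a (prePow b M : Term A V) = 0 := by
      rw [maxCount, weight_prePow, if_neg hab.symm, mul_zero]
    rw [depth_prePow] at e1
    obtain ⟨α, ⟨v', hα⟩, haα⟩ := exists_trace_mem (a := a) (p := subst σ r₂) (by omega)
    have hlen := sum_le_weight (fun _ => 1) ⟨v', hα⟩
    rcases α with _ | ⟨c, _ | ⟨d, α⟩⟩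
    · simp at haα
    · obtain rfl := List.mem_singleton.1 haα
      exact ⟨v', steps_singleton.1 hα⟩
    · simp only [List.map_cons, List.sum_cons] at hlen
      change _ ≤ depth (subst σ r₂) at hlen
      omega

/-! ### Derivations preserve the presence of a summand equivalent to `a ‖ p_N` -/

/-- The heart of the proof: in a closed instance equivalent to `a ‖ p_N` of a sound equation, if the
left-hand side has a summand equivalent to `a ‖ p_N`, then so does the right-hand side, provided that
the size of the left-hand side before instantiation is less than `N`. -/
theorem hasProperSummand_of_valid {a b : A} (hab : a ≠ b) {N : ℕ} (hN : 1 ≤ N) {t u : Term A V}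
    (h : Valid PFEquiv t u) (hsize : t.size < N) {σ : V → Term A V} (hσ : ClosedSubst σ)
    (ht : PFEquiv (subst σ t) (lhsN a b N))
    (hs : HasProperSummand (subst σ t) (lhsN a b N)) :
    HasProperSummand (subst σ u) (lhsN a b N) := by
  have hA : Nonempty A := ⟨a⟩
  -- a summand that is a parallel composition, with the factors ordered as in `a ‖ p_N`
  have key : ∀ t₁ t₂, par t₁ t₂ ∈ properSummands σ t ∨ par t₂ t₁ ∈ properSummands σ t →
      t₂.size + 1 < N → 0 < depth (subst σ t₂) → ∀ v, Step (subst σ t₁) a v →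
      HasProperSummand (subst σ u) (lhsN a b N) := by
    intro t₁ t₂ hm hsz h2 v hv
    obtain ⟨e₁, e₂⟩ := pfEquiv_factors_lhsN hab hN h2
      ((properPFLe_of_mem_or_mem hm).trans ht.properPFLe) hv
    have hstep : ∀ c v, Step (subst σ t₂) c v →
        c = b ∧ ∃ k, traces v = traces (bPowA a b k : Term A V) := by
      intro c v hv
      obtain ⟨w, hw, e⟩ := e₂.properPFLe.exists_step hv
      obtain ⟨rfl, k, -, rfl⟩ := step_pN.1 hw
      exact ⟨rfl, k, e.symm⟩
    -- `t₂` is too small for `N` different nonvariable summands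
    obtain ⟨x, hx⟩ : ∃ x, var x ∈ properSummands σ t₂ := by
      by_contra hx
      push Not at hx
      have := card_le_size_of_no_var_summand hab hx hstep (Finset.range N) fun i hi => by
        rw [e₂.traces_eq]
        exact cons_mem_traces_pN.2 (.inr ⟨i, Finset.mem_range.1 hi, rfl⟩)
      rw [Finset.card_range] at this
      omega
    -- `x` begins with `b`, so it does not occur in `t₁`, which is equivalent to `a`
    have hx₁ : ¬ Occurs x t₁ := by
      intro hx₁
      obtain ⟨c, v, hv⟩ := depth_pos_iff.1 (depth_pos_of_mem_properSummands hx)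
      obtain ⟨w, hw, -⟩ := (properPFLe_of_mem_properSummands hx).exists_step hv
      obtain ⟨rfl, -⟩ := hstep c w hw
      have h3 : 0 < maxCount c (subst σ (var x)) :=
        maxCount_pos_of_mem ⟨v, steps_singleton.2 hv⟩ (by simp)
      have h4 : maxCount c (subst σ (var x)) ≤ maxCount c (subst σ t₁) := hx₁.weight_le _ σ
      have h5 : maxCount c (subst σ t₁) = maxCount c (pre a zero : Term A V) :=
        weight_congr _ e₁.traces_eq
      simp only [weight, if_neg hab] at h5
      omega
    obtain ⟨u₁, u₂, hu, h3, h4, w, hw⟩ := exists_par_summand_of_valid hab h hσ hm e₁ hx₁ hx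
    obtain ⟨e₃, e₄⟩ := pfEquiv_factors_lhsN hab hN h3
      (((pfEquiv_par_comm _ _).properPFLe.trans (properPFLe_of_mem_or_mem hu)).trans
        (h σ hσ).symm.properPFLe |>.trans ht.properPFLe) hw
    refine hasProperSummand_subst_iff.2 ?_
    rcases hu with hu | hu
    · exact ⟨_, hu, (HasProperSummand.par_iff h3 h4).2
        ((e₄.par e₃).trans (pfEquiv_par_comm _ _))⟩
    · exact ⟨_, hu, (HasProperSummand.par_iff h4 h3).2 (e₃.par e₄)⟩
  obtain ⟨r, hr, hrs⟩ := hasProperSummand_subst_iff.1 hs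
  rcases cases_of_mem_properSummands hr with ⟨x, rfl, -⟩ | ⟨c, r', rfl⟩ | ⟨r₁, r₂, rfl, h1, h2⟩
  · exact hasProperSummand_subst_iff.2 ⟨_, var_mem_properSummands_of_valid h hσ hr, hrs⟩
  · exact absurd (HasProperSummand.pre_iff.1 hrs) (not_pfEquiv_pre_lhsN hab hN _)
  · have hsz := size_le_of_mem_properSummands hr
    simp only [size] at hsz
    obtain ⟨v, hv, -⟩ := ((HasProperSummand.par_iff h1 h2).1 hrs).symm.properPFLe.exists_step
      (step_lhsN.2 (.inl ⟨rfl, rfl⟩))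
    cases hv with
    | parLeft _ hv => exact key r₁ r₂ (.inl hr) (by omega) h2 _ hv
    | parRight _ hv => exact key r₂ r₁ (.inr hr) (by omega) h1 _ hv

/-- If `p + q` is equivalent to `s` and `p` has a summand equivalent to `s`, then `p` is equivalent
to `s`, since its possible futures lie between those of its summand and those of the sum. -/
theorem HasProperSummand.pfEquiv_left {p q s : Term A V} (h : PFEquiv (add p q) s)
    (hp : HasProperSummand p s) : PFEquiv p s := by
  obtain ⟨r, hr, e⟩ := hp
  have h1 : ProperPFLe s p := by
    have := properPFLe_of_mem_properSummands hr
    rw [subst_var, subst_var] at this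
    exact e.symm.properPFLe.trans this
  have h2 : ProperPFLe p s :=
    ProperPFLe.trans (fun c α p' hp => ⟨p', hp.addLeft q, rfl⟩) h.properPFLe
  exact .of_proper (h2.traces_subset.antisymm h1.traces_subset) h2 h1

theorem pfEquiv_add_comm (p q : Term A V) : PFEquiv (add p q) (add q p) := by
  have h : ∀ p q : Term A V, ProperPFLe (add p q) (add q p) :=
    fun p q c α r hr => ⟨r, steps_add.2 (steps_add.1 hr).symm, rfl⟩
  exact .of_proper ((h p q).traces_subset.antisymm (h q p).traces_subset) (h p q) (h q p)

/-- The closed instances of a derivable equation are equivalent, and if they are equivalent to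
`a ‖ p_N`, then both sides or neither have a summand equivalent to `a ‖ p_N`. -/
theorem hasProperSummand_iff_of_derivable {a b : A} (hab : a ≠ b) {N : ℕ} (hN : 1 ≤ N)
    {E : Set (Term A V × Term A V)} (hE : Sound PFEquiv E)
    (hsize : ∀ t u : Term A V, (t, u) ∈ E → t.size < N ∧ u.size < N) {t u : Term A V}
    (h : Derivable E t u) {σ : V → Term A V} (hσ : ClosedSubst σ) :
    PFEquiv (subst σ t) (subst σ u) ∧ (PFEquiv (subst σ t) (lhsN a b N) →
      (HasProperSummand (subst σ t) (lhsN a b N) ↔ HasProperSummand (subst σ u) (lhsN a b N))) := by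
  induction h generalizing σ with
  | @ax t u h =>
    have hv := hE t u h
    refine ⟨hv σ hσ, fun ht => ⟨?_, ?_⟩⟩
    · exact hasProperSummand_of_valid hab hN hv (hsize t u h).1 hσ ht
    · exact hasProperSummand_of_valid hab hN (fun τ hτ => (hv τ hτ).symm) (hsize t u h).2 hσ
        ((hv σ hσ).symm.trans ht)
  | refl t => exact ⟨.refl _, fun _ => Iff.rfl⟩
  | symm _ ih =>
    obtain ⟨h1, h2⟩ := ih hσ
    exact ⟨h1.symm, fun h => (h2 (h1.trans h)).symm⟩
  | trans _ _ ih ih' =>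
    obtain ⟨h1, h2⟩ := ih hσ
    obtain ⟨h3, h4⟩ := ih' hσ
    exact ⟨h1.trans h3, fun h => (h2 h).trans (h4 (h1.symm.trans h))⟩
  | subst τ _ ih =>
    rw [subst_subst, subst_subst]
    exact ih fun x => Closed.subst hσ _
  | pre c _ ih =>
    refine ⟨(ih hσ).1.pre c, fun _ => ?_⟩
    exact iff_of_false (fun h => not_pfEquiv_pre_lhsN hab hN _ (HasProperSummand.pre_iff.1 h))
      (fun h => not_pfEquiv_pre_lhsN hab hN _ (HasProperSummand.pre_iff.1 h))
  | add _ _ ih ih' =>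
    obtain ⟨h1, h2⟩ := ih hσ
    obtain ⟨h3, h4⟩ := ih' hσ
    refine ⟨h1.add h3, fun h => ?_⟩
    simp only [subst, HasProperSummand.add_iff] at h ⊢
    have h' := (h1.add h3).symm.trans h
    constructor
    · rintro (hs | hs)
      · exact .inl ((h2 (hs.pfEquiv_left h)).1 hs)
      · exact .inr ((h4 (hs.pfEquiv_left ((pfEquiv_add_comm _ _).trans h))).1 hs)
    · rintro (hs | hs)
      · exact .inl ((h2 (h1.trans (hs.pfEquiv_left h'))).2 hs)
      · exact .inr ((h4 (h3.trans (hs.pfEquiv_left ((pfEquiv_add_comm _ _).trans h')))).2 hs)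
  | @par t u t' u' _ _ ih ih' =>
    obtain ⟨h1, h2⟩ := ih hσ
    obtain ⟨h3, h4⟩ := ih' hσ
    refine ⟨h1.par h3, fun h => ?_⟩
    simp only [subst] at h ⊢
    have e1 : depth (subst σ t) = depth (subst σ u) := weight_congr _ h1.traces_eq
    have e3 : depth (subst σ t') = depth (subst σ u') := weight_congr _ h3.traces_eq
    rcases Nat.eq_zero_or_pos (depth (subst σ t')) with ht' | ht'
    · rw [HasProperSummand.par_iff_left ht', HasProperSummand.par_iff_left (e3 ▸ ht')]
      exact h2 ((pfEquiv_par_of_depth_eq_zero_right ht' _).symm.trans h)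
    · rcases Nat.eq_zero_or_pos (depth (subst σ t)) with ht | ht
      · rw [HasProperSummand.par_iff_right ht, HasProperSummand.par_iff_right (e1 ▸ ht)]
        exact h4 ((pfEquiv_par_of_depth_eq_zero ht _).symm.trans h)
      · rw [HasProperSummand.par_iff ht ht', HasProperSummand.par_iff (e1 ▸ ht) (e3 ▸ ht')]
        exact iff_of_true h ((h1.par h3).symm.trans h)

/-! ### The equations `e_N` -/

theorem closed_bPowA (a b : A) (k : ℕ) : (bPowA a b k : Term A V).Closed := by
  induction k with
  | zero => trivial
  | succ k ih => exact ih

theorem closed_sum {f : ℕ → Term A V} (h : ∀ i, (f i).Closed) (n : ℕ) : (sum f n).Closed := by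
  match n with
  | 0 => trivial
  | 1 => exact h 0
  | n + 2 => exact ⟨closed_sum h (n + 1), h (n + 1)⟩

theorem closed_pN (a b : A) (N : ℕ) : (pN a b N : Term A V).Closed :=
  closed_sum (fun i => closed_bPowA a b (i + 1)) N

theorem closed_lhsN (a b : A) (N : ℕ) : (lhsN a b N : Term A V).Closed :=
  ⟨trivial, closed_pN a b N⟩

theorem closed_rhsN (a b : A) (N : ℕ) : (rhsN a b N : Term A V).Closed :=
  ⟨closed_pN a b N, closed_sum (f := fun i => pre b (par (pre a zero) (bPowA a b i)))
    (fun i => ⟨trivial, closed_bPowA a b i⟩) N⟩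

theorem exists_eq_pre_of_mem_summands_sum {c : A} {f : ℕ → Term A V} {n : ℕ} {r : Term A V}
    (h : r ∈ summands (sum (fun i => pre c (f i)) n)) : ∃ t, r = pre c t := by
  match n with
  | 0 => exact h.elim
  | 1 => exact ⟨_, h⟩
  | n + 2 => exact h.elim exists_eq_pre_of_mem_summands_sum fun h => ⟨_, h⟩

theorem not_hasSummandEquiv_rhsN {a b : A} (hab : a ≠ b) {N : ℕ} (hN : 1 ≤ N) :
    ¬ HasSummandEquiv (rhsN a b N : Term A V) (lhsN a b N) := by
  rintro ⟨r, hr, e⟩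
  obtain ⟨c, t, rfl⟩ : ∃ c t, r = pre c t := by
    rcases hr with hr | hr
    · exact ⟨_, _, hr⟩
    · exact ⟨b, exists_eq_pre_of_mem_summands_sum hr⟩
  exact not_pfEquiv_pre_lhsN hab hN t e

theorem hasSummandEquiv_lhsN (a b : A) (N : ℕ) :
    HasSummandEquiv (lhsN a b N : Term A V) (lhsN a b N) :=
  ⟨_, rfl, .refl _⟩

theorem not_valid_zero_of_depth_pos {p : Term A V} (hp : p.Closed) (h : 0 < depth p) :
    ¬ Valid PFEquiv p zero := by
  intro hv
  have := hv (fun _ => zero) (fun _ => trivial)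
  rw [hp.subst_eq] at this
  exact h.ne' (pfEquiv_zero_iff.1 this)

theorem noZero_bPowA (a b : A) (k : ℕ) : (bPowA a b k : Term A V).NoZero := by
  induction k with
  | zero => trivial
  | succ k ih => exact ih

theorem depth_bPowA_pos (a b : A) (k : ℕ) : 0 < depth (bPowA a b k : Term A V) := by
  cases k <;> simp [bPowA, weight]

theorem depth_sum_pos {f : ℕ → Term A V} (h : ∀ i, 0 < depth (f i)) {n : ℕ} (hn : 1 ≤ n) :
    0 < depth (sum f n) :=
  (h 0).trans_le (le_weight_sum hn)

theorem noZero_sum {f : ℕ → Term A V} (hc : ∀ i, (f i).Closed) (h0 : ∀ i, 0 < depth (f i))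
    (h : ∀ i, (f i).NoZero) (n : ℕ) : (sum f n).NoZero := by
  match n with
  | 0 => trivial
  | 1 => exact h 0
  | n + 2 =>
    exact ⟨not_valid_zero_of_depth_pos (closed_sum hc _) (depth_sum_pos h0 (by omega)),
      not_valid_zero_of_depth_pos (hc _) (h0 _), noZero_sum hc h0 h _, h _⟩

theorem depth_pN_pos (a b : A) {N : ℕ} (hN : 1 ≤ N) : 0 < depth (pN a b N : Term A V) :=
  depth_sum_pos (fun i => depth_bPowA_pos a b (i + 1)) hN

theorem noZero_pN (a b : A) (N : ℕ) : (pN a b N : Term A V).NoZero :=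
  noZero_sum (fun i => closed_bPowA a b (i + 1)) (fun i => depth_bPowA_pos a b (i + 1))
    (fun i => noZero_bPowA a b (i + 1)) N

theorem depth_pre_pos (a : A) (t : Term A V) : 0 < depth (pre a t) := by simp [weight]

theorem noZero_lhsN (a b : A) {N : ℕ} (hN : 1 ≤ N) : (lhsN a b N : Term A V).NoZero :=
  ⟨not_valid_zero_of_depth_pos trivial (depth_pre_pos a zero),
    not_valid_zero_of_depth_pos (closed_pN a b N) (depth_pN_pos a b hN), trivial,
    noZero_pN a b N⟩

theorem noZero_rhsN (a b : A) {N : ℕ} (hN : 1 ≤ N) : (rhsN a b N : Term A V).NoZero := by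
  have hc : ∀ i, (pre b (par (pre a zero) (bPowA a b i)) : Term A V).Closed :=
    fun i => ⟨trivial, closed_bPowA a b i⟩
  have h0 : ∀ i, 0 < depth (pre b (par (pre a zero) (bPowA a b i)) : Term A V) :=
    fun i => depth_pre_pos b _
  exact ⟨not_valid_zero_of_depth_pos (closed_pN a b N) (depth_pre_pos a _),
    not_valid_zero_of_depth_pos (closed_sum hc N) (depth_sum_pos h0 hN), noZero_pN a b N,
    noZero_sum hc h0 (fun i => ⟨not_valid_zero_of_depth_pos trivial (depth_pre_pos a zero),
      not_valid_zero_of_depth_pos (closed_bPowA a b i) (depth_bPowA_pos a b i), trivial,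
      noZero_bPowA a b i⟩) N⟩

theorem hasSummandEquiv_of_derivable {a b : A} (hab : a ≠ b) {N : ℕ} (hN : 1 ≤ N)
    {E : Set (Term A V × Term A V)} (hE : Sound PFEquiv E)
    (hsize : ∀ t u : Term A V, (t, u) ∈ E → t.size < N ∧ u.size < N) {p q : Term A V}
    (hp : p.Closed) (hq : q.Closed) (hp0 : p.NoZero) (hq0 : q.NoZero)
    (hpN : PFEquiv p (lhsN a b N)) (h : Derivable E p q)
    (hs : HasSummandEquiv p (lhsN a b N)) : HasSummandEquiv q (lhsN a b N) := by
  have h1 := (hasProperSummand_iff_of_derivable hab hN hE hsize h (σ := fun _ => zero) (fun _ => trivial)).2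
  rw [hp.subst_eq, hq.subst_eq] at h1
  rw [hasSummandEquiv_iff hp hp0] at hs
  rw [hasSummandEquiv_iff hq hq0]
  exact (h1 hpN).1 hs

theorem not_derivable_lhsN_rhsN {a b : A} (hab : a ≠ b) {N : ℕ} (hN : 1 ≤ N)
    {E : Set (Term A V × Term A V)} (hE : Sound PFEquiv E)
    (hsize : ∀ t u : Term A V, (t, u) ∈ E → t.size < N ∧ u.size < N) :
    ¬ Derivable E (lhsN a b N) (rhsN a b N) := fun h =>
  not_hasSummandEquiv_rhsN hab hN (hasSummandEquiv_of_derivable hab hN hE hsize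
    (closed_lhsN a b N) (closed_rhsN a b N) (noZero_lhsN a b hN) (noZero_rhsN a b hN) (.refl _) h
    (hasSummandEquiv_lhsN a b N))

end BCCSP.Term

open BCCSP BCCSP.Term in
theorem mainTheorem1 {A : Type*} {V : Type*} [Finite A] [Countable V] [Infinite V]
    (hA : 2 ≤ Nat.card A) :
    (¬ HasFiniteGroundCompleteAxiomatisation (PFEquiv : Term A V → Term A V → Prop)) ∧
    (∀ a b : A, a ≠ b →
      (∀ N : ℕ, 1 ≤ N →
        Valid PFEquiv (lhsN a b N : Term A V) (rhsN a b N) ∧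
        HasSummandEquiv (lhsN a b N : Term A V) (lhsN a b N) ∧
        ¬ HasSummandEquiv (rhsN a b N : Term A V) (lhsN a b N)) ∧
      (∀ E : Set (Term A V × Term A V), E.Finite → Sound PFEquiv E →
        ∀ N : ℕ, 1 ≤ N → (∀ t u : Term A V, (t, u) ∈ E → t.size < N ∧ u.size < N) →
          ¬ Derivable E (lhsN a b N) (rhsN a b N) ∧
          ∀ p q : Term A V, p.Closed → q.Closed → p.NoZero → q.NoZero →
            PFEquiv p (lhsN a b N) → PFEquiv q (lhsN a b N) → Derivable E p q →
            HasSummandEquiv p (lhsN a b N) → HasSummandEquiv q (lhsN a b N))) := by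
  refine ⟨?_, fun a b hab => ⟨fun N hN => ⟨fun σ _ => ?_, hasSummandEquiv_lhsN a b N,
    not_hasSummandEquiv_rhsN hab hN⟩, fun E _ hE N hN hsize =>
    ⟨not_derivable_lhsN_rhsN hab hN hE hsize, fun p q hp hq hp0 hq0 hpN _ h hs =>
      hasSummandEquiv_of_derivable hab hN hE hsize hp hq hp0 hq0 hpN h hs⟩⟩⟩
  · rintro ⟨E, hfin, hE, hcomplete⟩
    have : Nontrivial A := Finite.one_lt_card_iff_nontrivial.1 hA
    obtain ⟨a, b, hab⟩ := exists_pair_ne A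
    obtain ⟨B, hB⟩ := (hfin.image fun e => e.1.size + e.2.size).bddAbove
    refine not_derivable_lhsN_rhsN hab (Nat.le_add_left 1 B) hE (fun t u h => ?_)
      (hcomplete _ _ (closed_lhsN a b _) (closed_rhsN a b _) (pfEquiv_lhsN_rhsN a b _))
    have : t.size + u.size ≤ B := hB ⟨(t, u), h, rfl⟩
    omega
  · rw [(closed_lhsN a b N).subst_eq, (closed_rhsN a b N).subst_eq]
    exact pfEquiv_lhsN_rhsN a b N
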